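/- Let $N\ge 1$ be an integer and $L,\omega,\alpha>0$. Consider an infinite chain of point particles of mass $1$ on $\mathbb R$ with coordinates $x_k(t)$, $k\in\mathbb Z$, $t\ge 0$, which is periodic, $x_{k+N}(t)=x_k(t)+L$, with initial coordinates $\ldots<x_{0}(0)<x_1(0)<x_2(0)<\ldots$ and arbitrary periodic initial velocities. Between collisions the particles obey Newton's equations $$\ddot x_k=\omega^2(x_{k+1}-2x_k+x_{k-1})-\alpha\dot x_k+f(t),\qquad k\in\mathbb Z,$$ with the same locally integrable external force $f:\mathbb R\to\mathbb R$ for all particles (if $f$ is not continuous, the equations are understood in integrated form). Collisions are elastic: whenever $x_k(t)=x_{k+1}(t)$, these two particles exchange their velocities, so that the order of the particles is conserved, while the velocities of the particles that do not collide at time $t$ do not jump; $\dot x_k(t)$ denotes the velocity after the collision if $t$ is a collision time. We consider trajectories of this dynamics on $[0,\infty)$ with finitely many collision times in every bounded time interval and without multiple collisions, i.e. $x_k(t)=x_{k+1}(t)=x_{k+2}(t)$ never occurs. Then for every such trajectory and all $k$, as $t\to\infty$, $$q_k(t)=x_{k+1}(t)-x_k(t)\to \frac LN .$$ Moreover: 1)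 If $f(t)\equiv f$ is constant, then $\dot x_k(t)\to f/\alpha$ for every such trajectory and all $k$. 2) If $f$ is $2\pi$-periodic and its Fourier series (in the sense of symmetric partial sums) converges to it at every point, $f(t)=\sum_{m\in\mathbb Z}a_me^{imt}$ with $a_m=\frac1{2\pi}\int_0^{2\pi}f(s)e^{-ims}\,ds$, then there exists a $2\pi$-periodic function $w:\mathbb R\to\mathbb R$, $$w(t)=\sum_{m\in\mathbb Z}\frac{a_m}{\alpha+im}e^{imt}$$ (convergent for every $t$ in the sense of symmetric partial sums), such that $\dot x_k(t)-w(t)\to0$ as $t\to\infty$ for every such trajectory and all $k$. 3) Let $f(t)$, $t\in\mathbb R$, be a real, jointly measurable, second-order (wide-sense) stationary process on a probability space, $\mathbf E f^2(s)<\infty$, with continuous covariance function, mean $\bar f=\mathbf E f(s)$ and orthogonal random measure $\mu(du)$, i.e. for every $s$, almost surely, $$f(s)=\bar f+\int_{\mathbb R}e^{isu}\,\mu(du).$$ Here $\mu$ is countably additive in mean square on the Borel sets of $\mathbb R$, with values in the complex $L^2$ space of the probability space and orthogonal on disjoint sets, and the integrals are the mean-square stochastic integrals with respect to $\mu$. Then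 there exists a real second-order stationary process $w(t)$, $t\in\mathbb R$, with $$w(t)=\frac{\bar f}{\alpha}+\int_{\mathbb R}e^{itu}(\alpha+iu)^{-1}\mu(du)\quad\text{a.s. for every }t,$$ such that almost surely, for every trajectory of the dynamics with force $f(\cdot)$ (for any initial conditions) and all $k$, $q_k(t)\to L/N$ and $\dot x_k(t)-w(t)\to0$ as $t\to\infty$. -/

import Mathlib

open MeasureTheory ProbabilityTheory Filter Topology

noncomputable section

/-- The times `t > 0` at which at least two neighbouring particles occupy the same point. -/
def collisionTimes (x : ℤ → ℝ → ℝ) : Set ℝ :=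
  {t | 0 < t ∧ ∃ k : ℤ, x k t = x (k + 1) t}

/-- `x k t` and `v k t` (`k ∈ ℤ`, `t ≥ 0`) are the coordinates and velocities of the `L`-periodic
chain with `N` particles per period, which obeys
`x_k'' = ω² (x_{k+1} - 2 x_k + x_{k-1}) - α x_k' + f(t)`
between collisions, while two colliding particles exchange velocities.  At a collision time `v` is
the velocity after the collision.  Newton's equation is written in integrated form, so that the
force `f` only has to be locally integrable; for continuous `f` this is the classical equation. -/
structure IsElasticTrajectory (N : ℕ) (L ω α : ℝ) (f : ℝ → ℝ) (x v : ℤ → ℝ → ℝ) : Prop where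
  /-- the configuration is periodic -/
  periodic_x : ∀ k t, 0 ≤ t → x (k + N) t = x k t + L
  periodic_v : ∀ k t, 0 ≤ t → v (k + N) t = v k t
  /-- initially the particles are at different points, numbered from left to right -/
  initial : ∀ k, x k 0 < x (k + 1) 0
  /-- the order of the particles is conserved -/
  ordered : ∀ k t, 0 ≤ t → x k t ≤ x (k + 1) t
  /-- the motion is continuous -/
  continuous_x : ∀ k, ContinuousOn (x k) (Set.Ici 0)
  /-- only finitely many collisions in finite time (piecewise smooth motion) -/
  finite_collisions : ∀ T, (collisionTimes x ∩ Set.Iic T).Finite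
  /-- no triple collisions -/
  no_triple : ∀ k t, 0 ≤ t → x k t = x (k + 1) t → x (k + 1) t ≠ x (k + 2) t
  /-- outside the collision times, `v` is the velocity -/
  velocity : ∀ k t, 0 < t → t ∉ collisionTimes x → HasDerivAt (x k) (v k t) t
  /-- Newton's equation between collisions -/
  newton : ∀ k s t, 0 ≤ s → s ≤ t → Disjoint (Set.Ioc s t) (collisionTimes x) →
    IntervalIntegrable (v k) volume s t ∧
    v k t = v k s + ∫ r in s..t,
      (ω ^ 2 * (x (k + 1) r - 2 * x k r + x (k - 1) r) - α * v k r + f r)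
  /-- colliding particles exchange velocities -/
  exchange : ∀ k t, 0 < t → x k t = x (k + 1) t →
    Tendsto (v k) (𝓝[<] t) (𝓝 (v (k + 1) t)) ∧ Tendsto (v (k + 1)) (𝓝[<] t) (𝓝 (v k t))
  /-- the velocities of the particles that do not take part in a collision do not jump -/
  no_jump : ∀ k t, 0 < t → x (k - 1) t ≠ x k t → x k t ≠ x (k + 1) t →
    Tendsto (v k) (𝓝[<] t) (𝓝 (v k t))

/-- The symmetric partial sums of the trigonometric series `∑ c_m e^{imt}`. -/
def trigPartialSum (c : ℤ → ℂ) (n : ℕ) (t : ℝ) : ℂ :=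
  ∑ m ∈ Finset.Icc (-(n : ℤ)) n, c m * Complex.exp (Complex.I * m * t)

/-- The Fourier coefficient `(2π)⁻¹ ∫_0^{2π} f(s) e^{-ims} ds`. -/
def fourierCoefficient (f : ℝ → ℝ) (m : ℤ) : ℂ :=
  (2 * (Real.pi : ℂ))⁻¹ * ∫ s in (0 : ℝ)..(2 * Real.pi), (f s : ℂ) * Complex.exp (-(Complex.I * m * s))

section Stationary

variable {Ω : Type*} [MeasurableSpace Ω]

/-- Second-order (wide-sense) stationary real processes. -/
structure IsSecondOrderStationary (P : Measure Ω) (f : ℝ → Ω → ℝ) : Prop where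
  memLp : ∀ t, MemLp (f t) 2 P
  mean : ∀ s t, ∫ ω, f s ω ∂P = ∫ ω, f t ω ∂P
  cov : ∀ s t h, covariance (f (s + h)) (f (t + h)) P = covariance (f s) (f t) P

/-- `Z` is an orthogonal random measure on the Borel sets of the line (countably additive in mean
square, uncorrelated on disjoint sets), with structure measure `G(A) = E|Z(A)|²`. -/
structure IsOrthogonalMeasure (P : Measure Ω) (Z : VectorMeasure ℝ (Lp ℂ 2 P)) (G : Measure ℝ) :
    Prop where
  orthogonal : ∀ A B, MeasurableSet A → MeasurableSet B → Disjoint A B → inner ℂ (Z A) (Z B) = 0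
  structure_measure : ∀ A, MeasurableSet A → G A = ENNReal.ofReal (‖Z A‖ ^ 2)

/-- The integral `∫ φ dZ = ∑ c · Z(φ = c)` of a simple function. -/
def simpleOrthogonalIntegral {P : Measure Ω} (Z : VectorMeasure ℝ (Lp ℂ 2 P))
    (φ : SimpleFunc ℝ ℂ) : Lp ℂ 2 P :=
  ∑ c ∈ φ.range, c • Z (φ ⁻¹' {c})

/-- `J = ∫ φ dZ` almost surely: the stochastic integral is the mean-square limit of the integrals
of simple functions that converge to `φ` in `L²(G)`, `G` being the structure measure of `Z`. -/
def HasOrthogonalIntegral {P : Measure Ω} (Z : VectorMeasure ℝ (Lp ℂ 2 P)) (G : Measure ℝ)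
    (φ : ℝ → ℂ) (J : Ω → ℂ) : Prop :=
  ∃ φn : ℕ → SimpleFunc ℝ ℂ,
    Tendsto (fun n => eLpNorm (fun u => φn n u - φ u) 2 G) atTop (𝓝 0) ∧
    Tendsto (fun n => eLpNorm (fun ω => simpleOrthogonalIntegral Z (φn n) ω - J ω) 2 P)
      atTop (𝓝 0)

end Stationary

end

/-! All particles feel the same force, so it disappears in a moving frame. Let `W` solve `W' = f - α
W` and measure the particles from the equally spaced configuration `k L/N + c + ∫ W`. The
displacements `y` and velocities `u` then form a periodic damped chain without force
(`IsElasticTrajectory.isCollidingChain`). Solutions `W` differ by multiples of `e^{-αt}`; the free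
constant and `c` are chosen so that `u` and `y` have mean zero initially, hence always.

Mechanical energy dissipates only through velocities, so `chainEnergy` adds a cross term
proportional to `∑ u y`. Its derivative between collisions is a negative multiple of `∑ (u² + ω²
(y_{k+1} - y_k)²)`, which controls the function itself by a discrete Poincaré inequality. At a
collision only the cross term changes, and it cannot grow: there `y_{k+1} - y_k = -L/N < 0`, while
after the exchange the right particle is not slower than the left one. So `chainEnergy` decays
exponentially through all collisions (`IsCollidingChain.chainEnergy_decay`), and the gaps tend to
`L/N` and `v - w` to zero for every solution `w` of the one-particle equation
(`IsElasticTrajectory.tendsto_gap_and_velocity`).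

It remains to exhibit suitable `w`. A constant force gives a constant. For a periodic force `w` is
the integral of `f` against a bounded kernel; the partial sums of the kernel's Fourier series are
uniformly bounded, and trigonometric polynomials are dense in `L¹`, so the series of `w` converges
at every point. For a stationary force `w` is an exponential average of the past. Fubini carries the
correspondence of inner products between `f(s) - f̄` in `L²(P)` and `e^{isu}` in `L²(G)` over to
averages, which gives both the spectral formula and stationarity. -/

/-! ### The one-particle equation. -/

/-- Solutions on the whole line of `w' = f - α w`, understood in integrated form. -/
structure IsRelaxationSolution (α : ℝ) (f w : ℝ → ℝ) : Prop where
  continuous : Continuous w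
  integral_eq : ∀ s t, w t = w s + ∫ r in s..t, (f r - α * w r)

theorem isRelaxationSolution_const {α : ℝ} (hα : 0 < α) (c : ℝ) :
    IsRelaxationSolution α (fun _ => c) (fun _ => c / α) where
  continuous := continuous_const
  integral_eq s t := by
    have : c - α * (c / α) = 0 := by field_simp; simp
    simp [this]

/-- Since `f` is only locally integrable, the product rule holds almost everywhere; absolute
continuity of both factors turns it into the integrated equation. -/
theorem isRelaxationSolution_duhamel (α : ℝ) {f : ℝ → ℝ} (hf : LocallyIntegrable f) (C : ℝ) :
    IsRelaxationSolution α f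
      (fun t => Real.exp (-(α * t)) * (C + ∫ s in (0 : ℝ)..t, Real.exp (α * s) * f s)) := by
  have hg : LocallyIntegrable (fun s => Real.exp (α * s) * f s) := by
    have hc : Continuous fun s : ℝ => Real.exp (α * s) := by fun_prop
    rw [← locallyIntegrableOn_univ] at hf ⊢
    exact hf.continuousOn_mul hc.continuousOn isOpen_univ.isLocallyClosed
  have hgi : ∀ a b, IntervalIntegrable (fun s => Real.exp (α * s) * f s) volume a b :=
    fun a b => (hg.integrableOn_isCompact isCompact_uIcc).intervalIntegrable
  set Φ : ℝ → ℝ := fun t => ∫ s in (0 : ℝ)..t, Real.exp (α * s) * f s with hΦ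
  have hΦc : Continuous Φ := intervalIntegral.continuous_primitive hgi 0
  refine ⟨(by fun_prop : Continuous fun t => Real.exp (-(α * t)) * (C + Φ t)), fun s t => ?_⟩
  have hexp : ∀ a b, AbsolutelyContinuousOnInterval (fun t => Real.exp (-(α * t))) a b :=
    fun a b => ContDiffOn.absolutelyContinuousOnInterval
      (by have : ContDiff ℝ 1 fun t : ℝ => Real.exp (-(α * t)) := by fun_prop
          exact this.contDiffOn)
  have hΦac : AbsolutelyContinuousOnInterval (fun t => C + Φ t) s t := by
    have h1 : AbsolutelyContinuousOnInterval (fun _ : ℝ => C) s t :=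
      ContDiffOn.absolutelyContinuousOnInterval contDiffOn_const
    have h2 : AbsolutelyContinuousOnInterval Φ (min s (min 0 t)) (max s (max 0 t)) :=
      (hgi _ _).absolutelyContinuousOnInterval_intervalIntegral (c := 0) (by
        rw [Set.uIcc_of_le (by simp)]; simp)
    refine h1.fun_add (h2.mono ?_)
    rw [Set.uIcc_of_le (by simp : min s (min 0 t) ≤ max s (max 0 t))]
    apply Set.uIcc_subset_Icc <;> simp
  have hac := (hexp s t).fun_mul hΦac
  have key := hac.integral_deriv_eq_sub
  have hcongr : ∫ r in s..t, deriv (fun x => Real.exp (-(α * x)) * (C + Φ x)) r =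
      ∫ r in s..t, (f r - α * (Real.exp (-(α * r)) * (C + Φ r))) := by
    apply intervalIntegral.integral_congr_ae
    filter_upwards [LocallyIntegrable.ae_hasDerivAt_integral hg] with x hx _
    have h1 : HasDerivAt (fun x => Real.exp (-(α * x))) (Real.exp (-(α * x)) * (-(α * 1))) x :=
      (((hasDerivAt_id x).const_mul α).neg).exp
    have h2 := h1.mul ((hx 0).const_add C)
    rw [show deriv (fun x => Real.exp (-(α * x)) * (C + Φ x)) x = _ from h2.deriv]
    have : Real.exp (-(α * x)) * (Real.exp (α * x) * f x) = f x := by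
      rw [← mul_assoc, ← Real.exp_add]; simp
    rw [this]; simp only [hΦ]; ring
  rw [← hcongr, key]; ring

/-- The homogeneous solutions leave the initial value free; this freedom later removes the mean
initial velocity. -/
theorem IsRelaxationSolution.add_exp {α : ℝ} {f w : ℝ → ℝ} (hf : LocallyIntegrable f)
    (hw : IsRelaxationSolution α f w) (c : ℝ) :
    IsRelaxationSolution α f (fun t => w t + c * Real.exp (-(α * t))) where
  continuous := by have := hw.continuous; fun_prop
  integral_eq s t := by
    have hd : ∀ x ∈ Set.uIcc s t, HasDerivAt (fun t => c * Real.exp (-(α * t)))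
        (-(α * (c * Real.exp (-(α * x))))) x := fun x _ => by
      have := ((((hasDerivAt_id x).const_mul α).neg).exp).const_mul c
      convert! this using 1; simp; ring
    have h1 := intervalIntegral.integral_eq_sub_of_hasDerivAt hd
      (by apply Continuous.intervalIntegrable; fun_prop)
    have h2 := hw.integral_eq s t
    have hc := hw.continuous
    have : ∫ r in s..t, (f r - α * (w r + c * Real.exp (-(α * r)))) =
        (∫ r in s..t, (f r - α * w r)) + ∫ r in s..t, -(α * (c * Real.exp (-(α * r)))) := by
      rw [← intervalIntegral.integral_add]
      · congr 1; ext r; ring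
      · exact (hf.integrableOn_isCompact isCompact_uIcc).intervalIntegrable.sub
          (by apply Continuous.intervalIntegrable; fun_prop)
      · apply Continuous.intervalIntegrable; fun_prop
    rw [this, h1, h2]; ring

/-! ### Monotonicity through collisions; periodic sequences. -/

/-- A function that does not increase between the points of a locally finite set `S`, and does not
jump up at the points of `S`, never exceeds its initial value. -/
theorem le_initial_of_antitone_between {F : ℝ → ℝ} {S : Set ℝ} (hS : ∀ t ∈ S, 0 < t)
    (hfin : ∀ T, (S ∩ Set.Iic T).Finite)
    (hbetween : ∀ s t, 0 ≤ s → s ≤ t → Disjoint (Set.Ioc s t) S → F t ≤ F s)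
    (hjump : ∀ t ∈ S, ∃ l, Tendsto F (𝓝[<] t) (𝓝 l) ∧ F t ≤ l) :
    ∀ t, 0 ≤ t → F t ≤ F 0 := by
  -- Induction on the number of points of `S` up to `t`. If `τ` is the last one, times just before
  -- `τ` have fewer points behind them, and the bound passes to the left limit at `τ`.
  have main : ∀ n : ℕ, ∀ t, 0 ≤ t → (S ∩ Set.Iic t).ncard = n → F t ≤ F 0 := by
    intro n
    induction n using Nat.strong_induction_on with
    | _ n ih =>
      intro t ht hn
      by_cases hne : (S ∩ Set.Iic t).Nonempty
      · obtain ⟨τ, ⟨hτS, hτt⟩, hmax⟩ := (hfin t).exists_maximal hne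
        have hτ0 := hS τ hτS
        have h1 : F t ≤ F τ := by
          refine hbetween τ t hτ0.le hτt ?_
          rw [Set.disjoint_left]
          rintro r ⟨hr1, hr2⟩ hrS
          exact absurd (hmax ⟨hrS, hr2⟩ hr1.le) (not_le.2 hr1)
        obtain ⟨l, hl, hFl⟩ := hjump τ hτS
        refine h1.trans (hFl.trans (le_of_tendsto hl ?_))
        have : ∀ᶠ s in 𝓝[<] τ, 0 < s :=
          mem_nhdsWithin_of_mem_nhds (lt_mem_nhds hτ0)
        filter_upwards [this, self_mem_nhdsWithin] with s hs0 hsτ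
        refine ih _ ?_ s hs0.le rfl
        rw [← hn]
        refine Set.ncard_lt_ncard ⟨?_, fun hsub => ?_⟩ (hfin t)
        · exact Set.inter_subset_inter_right _ (Set.Iic_subset_Iic.2 (hsτ.le.trans hτt))
        · exact absurd (Set.mem_Iic.1 (hsub ⟨hτS, hτt⟩).2) (not_le.2 hsτ)
      · refine hbetween 0 t le_rfl ht ?_
        rw [Set.disjoint_left]
        rintro r ⟨_, hr2⟩ hrS
        exact hne ⟨r, hrS, hr2⟩
  exact fun t ht => main _ t ht rfl

theorem Function.Periodic.sum_range_add_one {g : ℤ → ℝ} {N : ℕ} (hg : Function.Periodic g (N : ℤ)) :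
    ∑ k ∈ Finset.range N, g (k + 1) = ∑ k ∈ Finset.range N, g k := by
  have h := Finset.sum_range_sub (fun k : ℕ => g k) N
  rw [Finset.sum_sub_distrib] at h
  have h0 : g N = g 0 := by simpa using hg 0
  push_cast at h
  linarith

theorem Function.Periodic.sum_range_sub_one {g : ℤ → ℝ} {N : ℕ} (hg : Function.Periodic g (N : ℤ)) :
    ∑ k ∈ Finset.range N, g (k - 1) = ∑ k ∈ Finset.range N, g k := by
  have h : Function.Periodic (fun k => g (k - 1)) (N : ℤ) := fun k => by
    simp only [add_sub_right_comm]; exact hg _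
  have := h.sum_range_add_one
  simpa using this.symm

theorem Function.Periodic.exists_mem_range {β : Type*} {g : ℤ → β} {N : ℕ} (hN : 0 < N)
    (hg : Function.Periodic g (N : ℤ)) (k : ℤ) : ∃ j ∈ Finset.range N, g k = g j := by
  have hN' : (0 : ℤ) < N := by exact_mod_cast hN
  refine ⟨(k % N).toNat, ?_, ?_⟩
  · rw [Finset.mem_range]
    have := Int.emod_lt_of_pos k hN'
    have := Int.emod_nonneg k hN'.ne'
    omega
  · rw [Int.toNat_of_nonneg (Int.emod_nonneg k hN'.ne')]
    have := hg.sub_zsmul_eq (x := k) (k / N)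
    rw [← this]; congr 1
    have := Int.emod_add_mul_ediv k N
    simp only [zsmul_eq_mul, Int.cast_id]; linarith

/-- A discrete Poincaré inequality for periodic sequences of mean zero. -/
theorem sq_le_of_sum_eq_zero {y : ℤ → ℝ} {N : ℕ}
    (hsum : ∑ k ∈ Finset.range N, y k = 0) {k : ℕ} (hk : k ∈ Finset.range N) :
    y k ^ 2 ≤ 4 * N * ∑ j ∈ Finset.range N, (y (j + 1) - y j) ^ 2 := by
  -- `D` bounds every `|y j - y 0|`, and, the mean being zero, also `|y 0|`. So `|y k| ≤ 2 D`, and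
  -- Cauchy–Schwarz for `D` gives the constant `4 N`.
  set D := ∑ j ∈ Finset.range N, |y (j + 1) - y j| with hD
  have hbd : ∀ j ∈ Finset.range N, |y j - y 0| ≤ D := by
    intro j hj
    have h := Finset.sum_range_sub (fun k : ℕ => y k) j
    push_cast at h
    rw [← h]
    refine (Finset.abs_sum_le_sum_abs _ _).trans (Finset.sum_le_sum_of_subset_of_nonneg ?_ ?_)
    · exact Finset.range_subset_range.2 (Finset.mem_range.1 hj).le
    · intros; positivity
  have hNpos : (0 : ℝ) < N := by
    have := Finset.mem_range.1 hk
    exact_mod_cast (by omega : 0 < N)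
  have h0 : |y 0| ≤ D := by
    have h1 : (N : ℝ) * y 0 = -∑ j ∈ Finset.range N, (y j - y 0) := by
      rw [Finset.sum_sub_distrib, hsum]; simp
    have h2 : (N : ℝ) * |y 0| ≤ N * D := by
      rw [← abs_of_pos hNpos, ← abs_mul, h1, abs_neg, abs_of_pos hNpos]
      refine (Finset.abs_sum_le_sum_abs _ _).trans ?_
      refine (Finset.sum_le_sum hbd).trans ?_
      simp
    exact le_of_mul_le_mul_left h2 hNpos
  have h1 : |y k| ≤ 2 * D := by
    have := hbd k hk
    have h3 := abs_add_le (y k - y 0) (y 0)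
    rw [sub_add_cancel] at h3
    linarith
  have h2 : D ^ 2 ≤ N * ∑ j ∈ Finset.range N, (y (j + 1) - y j) ^ 2 := by
    have := sq_sum_le_card_mul_sum_sq (s := Finset.range N) (f := fun j : ℕ => |y (j + 1) - y j|)
    simpa using this
  have h3 : y k ^ 2 ≤ (2 * D) ^ 2 := by
    rw [← sq_abs]; exact pow_le_pow_left₀ (abs_nonneg _) h1 2
  nlinarith

theorem Function.Periodic.sum_range_sub_eq_zero {g : ℤ → ℝ} {N : ℕ}
    (hg : Function.Periodic g (N : ℤ)) : ∑ k ∈ Finset.range N, (g k - g (k - 1)) = 0 := by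
  rw [Finset.sum_sub_distrib, hg.sum_range_sub_one, sub_self]

theorem le_of_hasDerivAt_nonpos {F F' : ℝ → ℝ} {s t : ℝ} (hst : s ≤ t)
    (hc : ContinuousOn F (Set.Icc s t)) (hd : ∀ r ∈ Set.Ioo s t, HasDerivAt F (F' r) r)
    (hF' : ∀ r ∈ Set.Ioo s t, F' r ≤ 0) : F t ≤ F s := by
  refine antitoneOn_of_deriv_nonpos (convex_Icc s t) hc ?_ ?_ (Set.left_mem_Icc.2 hst)
    (Set.right_mem_Icc.2 hst) hst
  · rw [interior_Icc]
    exact fun r hr => (hd r hr).differentiableAt.differentiableWithinAt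
  · rw [interior_Icc]
    intro r hr
    rw [(hd r hr).deriv]
    exact hF' r hr

/-! ### The unforced colliding chain and its Lyapunov function. -/

/-- A periodic chain of displacements `y` and velocities `u` without external force, which obeys the
damped equations outside a locally finite set `S`; at the times in `S` some disjoint pairs of
neighbours (those with `c k = 1`) exchange velocities. -/
structure IsCollidingChain (N : ℕ) (ω α : ℝ) (S : Set ℝ) (y u : ℤ → ℝ → ℝ) : Prop where
  pos : ∀ t ∈ S, 0 < t
  finite : ∀ T, (S ∩ Set.Iic T).Finite
  periodic_y : ∀ t, 0 ≤ t → Function.Periodic (fun k => y k t) (N : ℤ)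
  periodic_u : ∀ t, 0 ≤ t → Function.Periodic (fun k => u k t) (N : ℤ)
  continuous_y : ∀ k, ContinuousOn (y k) (Set.Ici 0)
  continuous_u : ∀ k s t, 0 ≤ s → s ≤ t → Disjoint (Set.Ioc s t) S →
    ContinuousOn (u k) (Set.Icc s t)
  deriv_y : ∀ k s t, 0 ≤ s → s ≤ t → Disjoint (Set.Ioc s t) S → ∀ r ∈ Set.Ioo s t,
    HasDerivAt (y k) (u k r) r
  deriv_u : ∀ k s t, 0 ≤ s → s ≤ t → Disjoint (Set.Ioc s t) S → ∀ r ∈ Set.Ioo s t,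
    HasDerivAt (u k) (ω ^ 2 * (y (k + 1) r - 2 * y k r + y (k - 1) r) - α * u k r) r
  exchange : ∀ t ∈ S, ∃ c : ℤ → ℝ, Function.Periodic c (N : ℤ) ∧ (∀ k, c k = 0 ∨ c k = 1) ∧
    (∀ k, c k = 0 ∨ c (k - 1) = 0) ∧
    (∀ k, Tendsto (u k) (𝓝[<] t)
      (𝓝 (u k t + c k * (u (k + 1) t - u k t) + c (k - 1) * (u (k - 1) t - u k t)))) ∧
    ∀ k, c k * (u (k + 1) t - u k t) * (y (k + 1) t - y k t) ≤ 0

namespace IsCollidingChain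

variable {N : ℕ} {ω α : ℝ} {S : Set ℝ} {y u : ℤ → ℝ → ℝ}

/-- Exchanges conserve momentum: the corrections in the left limits are differences of the periodic
sequence `c k * (u (k + 1) t - u k t)`, and telescope. -/
theorem tendsto_sum_u (h : IsCollidingChain N ω α S y u) {t : ℝ} (ht : t ∈ S) :
    Tendsto (fun t => ∑ k ∈ Finset.range N, u k t) (𝓝[<] t)
      (𝓝 (∑ k ∈ Finset.range N, u k t)) := by
  obtain ⟨c, hcp, -, -, hlim, -⟩ := h.exchange t ht
  have hl := tendsto_finsetSum (Finset.range N) fun k _ => hlim (k : ℤ)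
  have hu := h.periodic_u t (h.pos t ht).le
  have hg : Function.Periodic (fun k => c k * (u (k + 1) t - u k t)) (N : ℤ) := fun k => by
    have e1 := hu k
    have e2 := hu (k + 1)
    simp only at e1 e2
    simp only [hcp k, e1, add_right_comm k (N : ℤ) 1, e2]
  have h0 := hg.sum_range_sub_eq_zero
  have heq : ∑ k ∈ Finset.range N, (u k t + c k * (u (k + 1) t - u k t) +
      c (k - 1) * (u (k - 1) t - u k t)) = ∑ k ∈ Finset.range N, u k t := by
    rw [← add_zero (∑ k ∈ Finset.range N, u k t), ← h0, ← Finset.sum_add_distrib]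
    refine Finset.sum_congr rfl fun k _ => ?_
    simp only [sub_add_cancel]; ring
  rwa [heq] at hl

theorem hasDerivAt_sum_u (h : IsCollidingChain N ω α S y u) {s t r : ℝ} (hs : 0 ≤ s)
    (hst : s ≤ t) (hd : Disjoint (Set.Ioc s t) S) (hr : r ∈ Set.Ioo s t) :
    HasDerivAt (fun t => ∑ k ∈ Finset.range N, u k t)
      (-α * ∑ k ∈ Finset.range N, u k r) r := by
  have h1 : HasDerivAt (fun t => ∑ k ∈ Finset.range N, u k t)
      (∑ k ∈ Finset.range N,
        (ω ^ 2 * (y (k + 1) r - 2 * y k r + y (k - 1) r) - α * u k r)) r :=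
    HasDerivAt.fun_sum fun k _ => h.deriv_u k s t hs hst hd r hr
  convert! h1 using 1
  have hper := h.periodic_y r (hs.trans hr.1.le)
  rw [Finset.sum_sub_distrib, ← Finset.mul_sum, ← Finset.mul_sum, Finset.sum_add_distrib,
    Finset.sum_sub_distrib, ← Finset.mul_sum]
  have e1 := hper.sum_range_add_one
  have e2 := hper.sum_range_sub_one
  rw [e1, e2]; ring

/-- The total momentum `p` satisfies `p' = -α p` and does not jump, so `p² e^{2αt}` is constant
between collisions and continuous across them. Squaring makes a one-sided bound enough for
vanishing. -/
theorem sum_u_eq_zero (h : IsCollidingChain N ω α S y u)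
    (h0 : ∑ k ∈ Finset.range N, u k 0 = 0) (t : ℝ) (ht : 0 ≤ t) :
    ∑ k ∈ Finset.range N, u k t = 0 := by
  obtain ⟨p, hp⟩ : ∃ p : ℝ → ℝ, p = fun t => ∑ k ∈ Finset.range N, u k t := ⟨_, rfl⟩
  have hpt : ∀ t, ∑ k ∈ Finset.range N, u k t = p t := fun t => by rw [hp]
  have hexp : Continuous fun t => Real.exp (2 * α * t) := by fun_prop
  have key := le_initial_of_antitone_between (F := fun t => p t ^ 2 * Real.exp (2 * α * t))
      h.pos h.finite
      (fun s t hs hst hd => by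
        refine le_of_hasDerivAt_nonpos (F := fun t => p t ^ 2 * Real.exp (2 * α * t))
          (F' := fun _ => 0) hst ?_ ?_ (fun _ _ => le_rfl)
        · have hpc : ContinuousOn p (Set.Icc s t) := by
            rw [hp]
            exact continuousOn_finsetSum _ fun k _ => h.continuous_u k s t hs hst hd
          exact (hpc.pow 2).mul hexp.continuousOn
        · intro r hr
          have h1 := h.hasDerivAt_sum_u hs hst hd hr
          rw [← hp, hpt] at h1
          have h3 : HasDerivAt (fun t => Real.exp (2 * α * t))
              (Real.exp (2 * α * r) * (2 * α * 1)) r :=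
            ((hasDerivAt_id r).const_mul (2 * α)).exp
          convert! (h1.pow 2).mul h3 using 1
          simp; ring)
      (fun t htS => by
        have h1 := h.tendsto_sum_u htS
        rw [← hp, hpt] at h1
        exact ⟨_, (h1.pow 2).mul ((hexp.tendsto t).mono_left nhdsWithin_le_nhds), le_rfl⟩)
      t ht
  rw [hpt] at h0 ⊢
  simp only [h0] at key
  have h1 : p t ^ 2 ≤ 0 := by
    by_contra! hcon
    have := mul_pos hcon (Real.exp_pos (2 * α * t))
    simp at key; linarith
  exact pow_eq_zero_iff two_ne_zero |>.1 (le_antisymm h1 (sq_nonneg _))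

theorem sum_y_eq_zero (h : IsCollidingChain N ω α S y u)
    (h0 : ∑ k ∈ Finset.range N, u k 0 = 0) (h0' : ∑ k ∈ Finset.range N, y k 0 = 0)
    (t : ℝ) (ht : 0 ≤ t) : ∑ k ∈ Finset.range N, y k t = 0 := by
  obtain ⟨m, hm⟩ : ∃ m : ℝ → ℝ, m = fun t => ∑ k ∈ Finset.range N, y k t := ⟨_, rfl⟩
  have hmt : ∀ t, ∑ k ∈ Finset.range N, y k t = m t := fun t => by rw [hm]
  have hcont : ContinuousOn m (Set.Ici 0) := by
    rw [hm]; exact continuousOn_finsetSum _ fun k _ => h.continuous_y k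
  have key := le_initial_of_antitone_between (F := fun t => m t ^ 2) h.pos h.finite
      (fun s t hs hst hd => by
        refine le_of_hasDerivAt_nonpos (F := fun t => m t ^ 2) (F' := fun _ => 0) hst
          ((hcont.pow 2).mono fun r hr => hs.trans hr.1) ?_ (fun _ _ => le_rfl)
        intro r hr
        have h1 : HasDerivAt (fun t => ∑ k ∈ Finset.range N, y k t)
            (∑ k ∈ Finset.range N, u k r) r :=
          HasDerivAt.fun_sum fun k _ => h.deriv_y k s t hs hst hd r hr
        rw [h.sum_u_eq_zero h0 r (hs.trans hr.1.le), ← hm] at h1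
        convert! h1.pow 2 using 1
        simp)
      (fun t htS => ⟨_, (((hcont.pow 2).continuousAt
        (Ici_mem_nhds (h.pos t htS))).tendsto.mono_left nhdsWithin_le_nhds), le_rfl⟩)
      t ht
  rw [hmt] at h0' ⊢
  have h1 : m t ^ 2 ≤ 0 := by simpa [h0'] using key
  exact pow_eq_zero_iff two_ne_zero |>.1 (le_antisymm h1 (sq_nonneg _))

end IsCollidingChain

/-- The strict Lyapunov function of the damped chain. -/
noncomputable def chainEnergy (N : ℕ) (ω α : ℝ) (y u : ℤ → ℝ) : ℝ :=
  ∑ k ∈ Finset.range N,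
    (u k ^ 2 / 4 + (u k + α * y k) ^ 2 / 4 + ω ^ 2 / 2 * (y (k + 1) - y k) ^ 2)

/-- Twice the dissipation rate of `chainEnergy`, divided by `α`. -/
noncomputable def chainDissipation (N : ℕ) (ω : ℝ) (y u : ℤ → ℝ) : ℝ :=
  ∑ k ∈ Finset.range N, (u k ^ 2 + ω ^ 2 * (y (k + 1) - y k) ^ 2)

/-- Only the `α² y²` contribution is not controlled site by site; mean zero and the Poincaré
inequality bound `∑ y²` by `4 N² / ω²` times the dissipation. -/
theorem chainEnergy_le {N : ℕ} {ω α : ℝ} (hω : 0 < ω) {y u : ℤ → ℝ}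
    (hsum : ∑ k ∈ Finset.range N, y k = 0) :
    chainEnergy N ω α y u ≤ (1 + 2 * α ^ 2 * N ^ 2 / ω ^ 2) * chainDissipation N ω y u := by
  have h1 : ω ^ 2 * ∑ k ∈ Finset.range N, y k ^ 2 ≤ 4 * N ^ 2 * chainDissipation N ω y u := by
    have h2 : ∑ k ∈ Finset.range N, y k ^ 2 ≤
        ∑ _k ∈ Finset.range N, 4 * N * ∑ j ∈ Finset.range N, (y (j + 1) - y j) ^ 2 :=
      Finset.sum_le_sum fun k hk => sq_le_of_sum_eq_zero hsum hk
    rw [Finset.sum_const, Finset.card_range, nsmul_eq_mul] at h2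
    have h3 : ω ^ 2 * ∑ j ∈ Finset.range N, (y (j + 1) - y j) ^ 2 ≤ chainDissipation N ω y u := by
      rw [Finset.mul_sum]
      exact Finset.sum_le_sum fun k _ => by nlinarith [sq_nonneg (u k)]
    calc ω ^ 2 * ∑ k ∈ Finset.range N, y k ^ 2
        ≤ ω ^ 2 * (N * (4 * N * ∑ j ∈ Finset.range N, (y (j + 1) - y j) ^ 2)) := by gcongr
      _ = 4 * N ^ 2 * (ω ^ 2 * ∑ j ∈ Finset.range N, (y (j + 1) - y j) ^ 2) := by ring
      _ ≤ _ := by gcongr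
  have h4 : chainEnergy N ω α y u ≤
      chainDissipation N ω y u + α ^ 2 / 2 * ∑ k ∈ Finset.range N, y k ^ 2 := by
    rw [chainEnergy, chainDissipation, Finset.mul_sum, ← Finset.sum_add_distrib]
    refine Finset.sum_le_sum fun k _ => ?_
    nlinarith [sq_nonneg (u k - α * y k), sq_nonneg (u k),
      sq_nonneg (ω * (y (k + 1) - y k)), sq_nonneg (α * y k)]
  have h5 : ∑ k ∈ Finset.range N, y k ^ 2 ≤ 4 * N ^ 2 * chainDissipation N ω y u / ω ^ 2 := by
    rw [le_div_iff₀ (by positivity)]; linarith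
  calc _ ≤ _ := h4
    _ ≤ chainDissipation N ω y u + α ^ 2 / 2 * (4 * N ^ 2 * chainDissipation N ω y u / ω ^ 2) := by
      gcongr
    _ = _ := by ring

theorem sq_le_chainEnergy {N : ℕ} (hN : 0 < N) {ω α : ℝ} {y u : ℤ → ℝ}
    (hy : Function.Periodic y (N : ℤ)) (hu : Function.Periodic u (N : ℤ)) (k : ℤ) :
    u k ^ 2 / 4 + ω ^ 2 / 2 * (y (k + 1) - y k) ^ 2 ≤ chainEnergy N ω α y u := by
  have hp : Function.Periodic (fun k => u k ^ 2 / 4 + ω ^ 2 / 2 * (y (k + 1) - y k) ^ 2) (N : ℤ) :=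
    fun k => by simp only [hu k, hy k, add_right_comm k (N : ℤ) 1, hy (k + 1)]
  obtain ⟨j, hj, hkj⟩ := hp.exists_mem_range hN k
  rw [hkj]
  refine le_trans ?_ (Finset.single_le_sum (f := fun k : ℕ =>
    (u k ^ 2 / 4 + (u k + α * y k) ^ 2 / 4 + ω ^ 2 / 2 * (y (k + 1) - y k) ^ 2))
    (fun k _ => by positivity) hj)
  nlinarith [sq_nonneg (u j + α * y j)]

namespace IsCollidingChain

variable {N : ℕ} {ω α : ℝ} {S : Set ℝ} {y u : ℤ → ℝ → ℝ}

theorem hasDerivAt_chainEnergy (h : IsCollidingChain N ω α S y u) {s t r : ℝ} (hs : 0 ≤ s)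
    (hst : s ≤ t) (hd : Disjoint (Set.Ioc s t) S) (hr : r ∈ Set.Ioo s t) :
    HasDerivAt (fun t => chainEnergy N ω α (fun k => y k t) (fun k => u k t))
      (-(α / 2) * chainDissipation N ω (fun k => y k r) (fun k => u k r)) r := by
  -- Summation by parts in local form: a dissipation density plus a difference of fluxes between
  -- neighbouring bonds, which telescopes over a period.
  have hterm : ∀ k : ℤ, HasDerivAt
      (fun t => u k t ^ 2 / 4 + (u k t + α * y k t) ^ 2 / 4 + ω ^ 2 / 2 * (y (k + 1) t - y k t) ^ 2)
      (-(α / 2) * (u k r ^ 2 + ω ^ 2 * (y (k + 1) r - y k r) ^ 2) +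
        (ω ^ 2 * ((y (k + 1) r - y k r) * (u (k + 1) r + α / 2 * y (k + 1) r)) -
         ω ^ 2 * ((y k r - y (k - 1) r) * (u k r + α / 2 * y k r)))) r := by
    intro k
    have hu := h.deriv_u k s t hs hst hd r hr
    have hy := h.deriv_y k s t hs hst hd r hr
    have hy1 := h.deriv_y (k + 1) s t hs hst hd r hr
    have := (((hu.pow 2).div_const 4).add (((hu.add (hy.const_mul α)).pow 2).div_const 4)).add
      (((hy1.sub hy).pow 2).const_mul (ω ^ 2 / 2))
    convert! this using 1
    simp; ring
  have hsum := HasDerivAt.fun_sum (u := Finset.range N) fun k _ => hterm (k : ℤ)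
  convert! hsum using 1
  rw [Finset.sum_add_distrib, ← Finset.mul_sum, chainDissipation]
  have hr0 : 0 ≤ r := hs.trans hr.1.le
  have hyp := h.periodic_y r hr0
  have hup := h.periodic_u r hr0
  have hg : Function.Periodic (fun k => ω ^ 2 * ((y (k + 1) r - y k r) *
      (u (k + 1) r + α / 2 * y (k + 1) r))) (N : ℤ) := fun k => by
    have e1 := hyp k
    have e2 := hyp (k + 1)
    have e3 := hup (k + 1)
    simp only at e1 e2 e3
    simp only [e1, add_right_comm k (N : ℤ) 1, e2, e3]
  have := hg.sum_range_sub_eq_zero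
  simp only [sub_add_cancel] at this
  rw [this, add_zero]

/-- An exchange permutes the squares `u k ^ 2` and leaves `y` alone, so only the cross term `α/2 * ∑
u k * y k` jumps. Each exchanged pair lowers it by `-(α/2) (u_{k+1} - u_k)(y_{k+1} - y_k) ≥ 0`. -/
theorem chainEnergy_jump (h : IsCollidingChain N ω α S y u) (hα : 0 < α) {t : ℝ} (ht : t ∈ S) :
    ∃ l, Tendsto (fun t => chainEnergy N ω α (fun k => y k t) (fun k => u k t)) (𝓝[<] t) (𝓝 l) ∧
      chainEnergy N ω α (fun k => y k t) (fun k => u k t) ≤ l := by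
  obtain ⟨c, hcp, hc01, hcc, hlim, hsign⟩ := h.exchange t ht
  have ht0 := h.pos t ht
  have hylim : ∀ k, Tendsto (y k) (𝓝[<] t) (𝓝 (y k t)) := fun k =>
    ((h.continuous_y k).continuousAt (Ici_mem_nhds ht0)).tendsto.mono_left nhdsWithin_le_nhds
  refine ⟨_, tendsto_finsetSum _ fun k _ => (((hlim k).pow 2).div_const 4).add
    ((((hlim k).add ((hylim k).const_mul α)).pow 2).div_const 4) |>.add
      ((((hylim (k + 1)).sub (hylim k)).pow 2).const_mul (ω ^ 2 / 2)), ?_⟩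
  rw [← sub_nonneg, chainEnergy, ← Finset.sum_sub_distrib]
  have hyp := h.periodic_y t ht0.le
  have hup := h.periodic_u t ht0.le
  have hg : Function.Periodic (fun k => c k * (u (k + 1) t ^ 2 - u k t ^ 2) / 2 +
      α / 2 * (c k * (u (k + 1) t - u k t) * y (k + 1) t)) (N : ℤ) := fun k => by
    have e1 := hup k
    have e2 := hyp (k + 1)
    have e3 := hup (k + 1)
    simp only at e1 e2 e3
    simp only [hcp k, e1, add_right_comm k (N : ℤ) 1, e2, e3]
  have h0 := hg.sum_range_sub_eq_zero
  have h1 : 0 ≤ ∑ k ∈ Finset.range N,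
      -(α / 2 * (c k * (u (k + 1) t - u k t) * (y (k + 1) t - y k t))) :=
    Finset.sum_nonneg fun k _ => by nlinarith [hsign k]
  have h2 := add_nonneg h1 h0.ge
  rw [← Finset.sum_add_distrib] at h2
  refine h2.trans_eq (Finset.sum_congr rfl fun k _ => ?_)
  simp only [sub_add_cancel]
  -- Each particle takes part in at most one exchange, so running through the possible values of `c`
  -- makes the squared left limits explicit.
  rcases hcc k with hk | hk <;> rcases hc01 k with hk' | hk' <;>
    rcases hc01 (k - 1) with hk'' | hk'' <;> simp_all <;> ring

theorem chainEnergy_decay (h : IsCollidingChain N ω α S y u) (hω : 0 < ω) (hα : 0 < α)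
    (h0 : ∑ k ∈ Finset.range N, u k 0 = 0) (h0' : ∑ k ∈ Finset.range N, y k 0 = 0) :
    Tendsto (fun t => chainEnergy N ω α (fun k => y k t) (fun k => u k t)) atTop (𝓝 0) := by
  set B := 1 + 2 * α ^ 2 * N ^ 2 / ω ^ 2 with hB
  have hBpos : 0 < B := by positivity
  -- With `E ≤ B D` and `E' = -(α/2) D`, this is the rate for which `E' ≤ -c E`.
  set c := α / (2 * B) with hc
  have hcpos : 0 < c := by positivity
  set E := fun t => chainEnergy N ω α (fun k => y k t) (fun k => u k t) with hE
  have key : ∀ t, 0 ≤ t → Real.exp (c * t) * E t ≤ Real.exp (c * 0) * E 0 := by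
    refine le_initial_of_antitone_between (F := fun t => Real.exp (c * t) * E t)
      h.pos h.finite ?_ ?_
    · intro s t hs hst hd
      refine le_of_hasDerivAt_nonpos (F := fun t => Real.exp (c * t) * E t)
        (F' := fun r => Real.exp (c * r) * (c * 1) * E r +
        Real.exp (c * r) *
          (-(α / 2) * chainDissipation N ω (fun k => y k r) (fun k => u k r))) hst ?_ ?_ ?_
      · refine ContinuousOn.mul (Continuous.continuousOn (by fun_prop)) ?_
        refine continuousOn_finsetSum _ fun k _ => ?_
        have c1 := h.continuous_u k s t hs hst hd
        have c2 : ∀ k, ContinuousOn (y k) (Set.Icc s t) := fun k =>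
          (h.continuous_y k).mono fun r hr => hs.trans hr.1
        have c3 := c2 k
        have c4 := c2 (k + 1)
        fun_prop
      · intro r hr
        exact (((hasDerivAt_id r).const_mul c).exp).mul (h.hasDerivAt_chainEnergy hs hst hd hr)
      · intro r hr
        have h1 : E r ≤ B * chainDissipation N ω (fun k => y k r) (fun k => u k r) :=
          chainEnergy_le hω (h.sum_y_eq_zero h0 h0' r (hs.trans hr.1.le))
        have h2 : c * E r ≤ α / 2 * chainDissipation N ω (fun k => y k r) (fun k => u k r) := by
          calc c * E r ≤ c * (B * chainDissipation N ω (fun k => y k r) (fun k => u k r)) := by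
                gcongr
            _ = _ := by rw [hc]; field_simp
        have h3 := Real.exp_pos (c * r)
        have : Real.exp (c * r) * (c * 1) * E r + Real.exp (c * r) *
          (-(α / 2) * chainDissipation N ω (fun k => y k r) (fun k => u k r)) =
          -(Real.exp (c * r) *
            (α / 2 * chainDissipation N ω (fun k => y k r) (fun k => u k r) - c * E r)) := by ring
        rw [this]
        exact neg_nonpos.2 (mul_nonneg h3.le (sub_nonneg.2 h2))
    · intro t ht
      obtain ⟨l, hl, hle⟩ := h.chainEnergy_jump hα ht
      refine ⟨_, ((Continuous.tendsto (by fun_prop : Continuous fun t => Real.exp (c * t))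
        t).mono_left nhdsWithin_le_nhds).mul hl, ?_⟩
      exact mul_le_mul_of_nonneg_left hle (Real.exp_pos _).le
  have hlim : Tendsto (fun t => E 0 * Real.exp (-(c * t))) atTop (𝓝 0) := by
    have : Tendsto (fun t => Real.exp (-(c * t))) atTop (𝓝 0) :=
      Real.tendsto_exp_neg_atTop_nhds_zero.comp (tendsto_id.const_mul_atTop hcpos)
    simpa using this.const_mul (E 0)
  refine tendsto_of_tendsto_of_tendsto_of_le_of_le' tendsto_const_nhds hlim ?_ ?_
  · exact Eventually.of_forall fun t => Finset.sum_nonneg fun k _ => by positivity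
  · filter_upwards [eventually_ge_atTop 0] with t ht
    have := key t ht
    rw [Real.exp_neg, ← div_eq_mul_inv, le_div_iff₀ (Real.exp_pos _)]
    simpa [mul_comm] using this

theorem tendsto_zero (h : IsCollidingChain N ω α S y u) (hN : 0 < N) (hω : 0 < ω) (hα : 0 < α)
    (h0 : ∑ k ∈ Finset.range N, u k 0 = 0) (h0' : ∑ k ∈ Finset.range N, y k 0 = 0) (k : ℤ) :
    Tendsto (u k) atTop (𝓝 0) ∧ Tendsto (fun t => y (k + 1) t - y k t) atTop (𝓝 0) := by
  have hE := h.chainEnergy_decay hω hα h0 h0'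
  have hbd : ∀ᶠ t in atTop, u k t ^ 2 / 4 + ω ^ 2 / 2 * (y (k + 1) t - y k t) ^ 2 ≤
      chainEnergy N ω α (fun k => y k t) (fun k => u k t) := by
    filter_upwards [eventually_ge_atTop 0] with t ht
    exact sq_le_chainEnergy hN (h.periodic_y t ht) (h.periodic_u t ht) k
  have sq : ∀ g : ℝ → ℝ, Tendsto (fun t => g t ^ 2) atTop (𝓝 0) → Tendsto g atTop (𝓝 0) := by
    intro g hg
    have := hg.sqrt
    simp only [Real.sqrt_sq_eq_abs, Real.sqrt_zero] at this
    exact (tendsto_zero_iff_abs_tendsto_zero g).2 this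
  constructor
  · refine sq _ (tendsto_of_tendsto_of_tendsto_of_le_of_le' tendsto_const_nhds
      (g := fun _ => 0) (by simpa using hE.const_mul 4) (Eventually.of_forall fun t => sq_nonneg _)
      ?_)
    filter_upwards [hbd] with t ht
    nlinarith [mul_nonneg (by positivity : 0 ≤ ω ^ 2 / 2) (sq_nonneg (y (k + 1) t - y k t))]
  · refine sq _ (tendsto_of_tendsto_of_tendsto_of_le_of_le' tendsto_const_nhds
      (g := fun _ => 0) (by simpa using hE.const_mul (2 / ω ^ 2))
      (Eventually.of_forall fun t => sq_nonneg _) ?_)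
    filter_upwards [hbd] with t ht
    rw [div_mul_eq_mul_div, le_div_iff₀ (by positivity)]
    nlinarith [sq_nonneg (u k t)]

end IsCollidingChain

/-! ### Reduction of elastic trajectories to the unforced chain. -/

namespace IsElasticTrajectory

variable {N : ℕ} {L ω α : ℝ} {f : ℝ → ℝ} {x v : ℤ → ℝ → ℝ}

theorem continuousOn_spring (h : IsElasticTrajectory N L ω α f x v) (k : ℤ) :
    ContinuousOn (fun r => ω ^ 2 * (x (k + 1) r - 2 * x k r + x (k - 1) r)) (Set.Ici 0) := by
  have c0 := h.continuous_x k
  have c1 := h.continuous_x (k + 1)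
  have c2 := h.continuous_x (k - 1)
  fun_prop

theorem intervalIntegrable_force (h : IsElasticTrajectory N L ω α f x v) (hf : LocallyIntegrable f)
    (k : ℤ) {s t : ℝ} (hs : 0 ≤ s) (hst : s ≤ t)
    (hd : Disjoint (Set.Ioc s t) (collisionTimes x)) :
    IntervalIntegrable (fun r => ω ^ 2 * (x (k + 1) r - 2 * x k r + x (k - 1) r) - α * v k r + f r)
      volume s t := by
  refine (IntervalIntegrable.sub ?_ ((h.newton k s t hs hst hd).1.const_mul α)).add
    (hf.integrableOn_isCompact isCompact_uIcc).intervalIntegrable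
  refine ((h.continuousOn_spring k).mono fun r hr => ?_).intervalIntegrable
  rw [Set.uIcc_of_le hst] at hr
  exact hs.trans hr.1

theorem continuousOn_velocity (h : IsElasticTrajectory N L ω α f x v) (hf : LocallyIntegrable f)
    (k : ℤ) {s t : ℝ} (hs : 0 ≤ s) (hst : s ≤ t)
    (hd : Disjoint (Set.Ioc s t) (collisionTimes x)) : ContinuousOn (v k) (Set.Icc s t) := by
  have hi := h.intervalIntegrable_force hf k hs hst hd
  have h1 := intervalIntegral.continuousOn_primitive_interval
    ((intervalIntegrable_iff_integrableOn_Icc_of_le hst (by simp)).1 hi |>.mono_set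
      (Set.uIcc_of_le hst).le)
  rw [Set.uIcc_of_le hst] at h1
  refine (h1.const_add (v k s)).congr fun r hr => ?_
  exact (h.newton k s r hs hr.1 (hd.mono_left (Set.Ioc_subset_Ioc_right hr.2))).2

theorem exists_disjoint_Ioc (h : IsElasticTrajectory N L ω α f x v) (t : ℝ) :
    ∃ T, t < T ∧ Disjoint (Set.Ioc t T) (collisionTimes x) := by
  have hfin : ((collisionTimes x ∩ Set.Iic (t + 1)) \ {t}).Finite :=
    (h.finite_collisions (t + 1)).subset Set.sdiff_subset
  have hmem : ((collisionTimes x ∩ Set.Iic (t + 1)) \ {t})ᶜ ∈ 𝓝 t :=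
    hfin.isClosed.isOpen_compl.mem_nhds (by simp)
  obtain ⟨ε, hε, hball⟩ := Metric.mem_nhds_iff.1 hmem
  have hε' : 0 < min (ε / 2) 1 := lt_min (by positivity) one_pos
  refine ⟨t + min (ε / 2) 1, by linarith, Set.disjoint_left.2 fun r hr hrS => ?_⟩
  have h1 := min_le_left (ε / 2) 1
  have h2 := min_le_right (ε / 2) 1
  have hr1 := hr.1
  have hr2 := hr.2
  refine hball (a := r) ?_ ⟨⟨hrS, Set.mem_Iic.2 (by linarith)⟩, hr.1.ne'⟩
  rw [Metric.mem_ball, Real.dist_eq, abs_of_pos (by linarith)]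
  linarith

/-- Otherwise, by right continuity of the velocities, the gap would not increase from zero during a
short collision-free time; since the order is preserved it would stay zero, which is another
collision. -/
theorem velocity_le_of_collision (h : IsElasticTrajectory N L ω α f x v) (hf : LocallyIntegrable f)
    {k : ℤ} {t : ℝ} (ht : 0 ≤ t) (hx : x k t = x (k + 1) t) : v k t ≤ v (k + 1) t := by
  obtain ⟨T, htT, hd⟩ := h.exists_disjoint_Ioc t
  by_contra! hlt
  have hcont : ContinuousOn (fun r => v (k + 1) r - v k r) (Set.Icc t T) :=
    (h.continuousOn_velocity hf (k + 1) ht htT.le hd).sub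
      (h.continuousOn_velocity hf k ht htT.le hd)
  have hev : ∀ᶠ r in 𝓝[Set.Icc t T] t, v (k + 1) r - v k r < 0 :=
    (hcont t (Set.left_mem_Icc.2 htT.le)).eventually_lt_const (sub_neg.2 hlt)
  rw [nhdsWithin_Icc_eq_nhdsGE htT] at hev
  obtain ⟨b, hb, hbsub⟩ := (mem_nhdsGE_iff_exists_mem_Ioc_Ico_subset htT).1 hev
  set τ := min b T with hτ
  have htτ : t < τ := lt_min hb.1 htT
  have hdτ : Disjoint (Set.Ioc t τ) (collisionTimes x) :=
    hd.mono_left (Set.Ioc_subset_Ioc_right (min_le_right _ _))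
  have h1 : x (k + 1) τ - x k τ ≤ x (k + 1) t - x k t := by
    refine le_of_hasDerivAt_nonpos (F := fun r => x (k + 1) r - x k r)
      (F' := fun r => v (k + 1) r - v k r) htτ.le ?_ ?_ ?_
    · exact ((h.continuous_x (k + 1)).sub (h.continuous_x k)).mono fun r hr => ht.trans hr.1
    · intro r hr
      have hr0 := ht.trans_lt hr.1
      have hrS := Set.disjoint_left.1 hdτ ⟨hr.1, hr.2.le⟩
      exact (h.velocity (k + 1) r hr0 hrS).sub (h.velocity k r hr0 hrS)
    · intro r hr
      exact (hbsub ⟨hr.1.le, hr.2.trans_le (min_le_left _ _)⟩ : v (k + 1) r - v k r < 0).le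
  have h2 := h.ordered k τ (ht.trans htτ.le)
  exact Set.disjoint_left.1 hdτ ⟨htτ, le_rfl⟩ ⟨ht.trans_lt htτ, k, by linarith⟩

/-- Relative to a solution of the one-particle equation, an elastic trajectory is a chain without
external force. -/
theorem isCollidingChain (h : IsElasticTrajectory N L ω α f x v) (hN : 0 < N) (hL : 0 < L)
    (hf : LocallyIntegrable f) {W : ℝ → ℝ} (hW : IsRelaxationSolution α f W) (c : ℝ) :
    IsCollidingChain N ω α (collisionTimes x)
      (fun k t => x k t - k * (L / N) - c - ∫ s in (0 : ℝ)..t, W s) (fun k t => v k t - W t) := by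
  have hN' : (N : ℝ) ≠ 0 := by exact_mod_cast hN.ne'
  have hprim : ∀ r, HasDerivAt (fun t => ∫ s in (0 : ℝ)..t, W s) (W r) r := fun r =>
    intervalIntegral.integral_hasDerivAt_right (hW.continuous.intervalIntegrable _ _)
      hW.continuous.aestronglyMeasurable.stronglyMeasurableAtFilter hW.continuous.continuousAt
  have hcy : ∀ k : ℤ, ContinuousOn
      (fun t => x k t - k * (L / N) - c - ∫ s in (0 : ℝ)..t, W s) (Set.Ici 0) := fun k =>
    (((h.continuous_x k).sub continuousOn_const).sub continuousOn_const).sub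
      (continuous_iff_continuousAt.2 fun r => (hprim r).continuousAt).continuousOn
  have hcu : ∀ (k : ℤ) s t, 0 ≤ s → s ≤ t → Disjoint (Set.Ioc s t) (collisionTimes x) →
      ContinuousOn (fun t => v k t - W t) (Set.Icc s t) := fun k s t hs hst hd =>
    (h.continuousOn_velocity hf k hs hst hd).sub hW.continuous.continuousOn
  refine ⟨fun t ht => ht.1, h.finite_collisions, fun t ht k => ?_, fun t ht k => ?_, hcy, hcu, ?_,
    ?_, ?_⟩
  · simp only [h.periodic_x k t ht]
    push_cast
    field_simp
    ring
  · simp only [h.periodic_v k t ht]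
  · intro k s t hs hst hd r hr
    have hrS := Set.disjoint_left.1 hd ⟨hr.1, hr.2.le⟩
    exact (((h.velocity k r (hs.trans_lt hr.1) hrS).sub_const _).sub_const _).sub (hprim r)
  · intro k s t hs hst hd r hr
    have hg : ContinuousOn (fun r => ω ^ 2 * (x (k + 1) r - 2 * x k r + x (k - 1) r) -
        α * (v k r - W r)) (Set.Icc s t) :=
      ((h.continuousOn_spring k).mono fun r hr => hs.trans hr.1).sub
        (continuousOn_const.mul (hcu k s t hs hst hd))
    -- Subtracting the two integrated equations cancels `f` and leaves a continuous integrand, so `v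
    -- - W` is classically differentiable although `v` need not be.
    have heq : ∀ τ ∈ Set.Icc s t, v k τ - W τ = (v k s - W s) +
        ∫ r in s..τ, (ω ^ 2 * (x (k + 1) r - 2 * x k r + x (k - 1) r) - α * (v k r - W r)) := by
      intro τ hτ
      have hdτ := hd.mono_left (Set.Ioc_subset_Ioc_right hτ.2)
      rw [(h.newton k s τ hs hτ.1 hdτ).2, hW.integral_eq s τ, add_sub_add_comm,
        ← intervalIntegral.integral_sub]
      · congr 2; ext r; ring
      · exact h.intervalIntegrable_force hf k hs hτ.1 hdτ
      · exact (hf.integrableOn_isCompact isCompact_uIcc).intervalIntegrable.sub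
          ((continuous_const.mul hW.continuous).intervalIntegrable _ _)
    have hder : HasDerivAt (fun τ => ∫ r in s..τ,
        (ω ^ 2 * (x (k + 1) r - 2 * x k r + x (k - 1) r) - α * (v k r - W r)))
        (ω ^ 2 * (x (k + 1) r - 2 * x k r + x (k - 1) r) - α * (v k r - W r)) r := by
      have hnhds : Set.Icc s t ∈ 𝓝 r := Icc_mem_nhds hr.1 hr.2
      refine intervalIntegral.integral_hasDerivAt_right ?_ ?_ (hg.continuousAt hnhds)
      · refine (hg.mono ?_).intervalIntegrable
        rw [Set.uIcc_of_le hr.1.le]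
        exact Set.Icc_subset_Icc_right hr.2.le
      · exact ⟨Set.Icc s t, hnhds, hg.aestronglyMeasurable measurableSet_Icc⟩
    have h1 := (hder.const_add (v k s - W s)).congr_of_eventuallyEq
      (Filter.eventuallyEq_of_mem (Icc_mem_nhds hr.1 hr.2) heq)
    convert! h1 using 1
    push_cast; ring
  · intro t ht
    have ht0 := ht.1
    classical
    -- `c k` marks the bonds that collide at `t`; the absence of triple collisions makes the marked
    -- bonds disjoint.
    refine ⟨fun k => if x k t = x (k + 1) t then 1 else 0, fun k => ?_, fun k => ?_, fun k => ?_,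
      fun k => ?_, fun k => ?_⟩
    · have e1 := h.periodic_x k t ht0.le
      have e2 := h.periodic_x (k + 1) t ht0.le
      simp only [add_right_comm k (N : ℤ) 1, e1, e2, add_left_inj]
    · by_cases hk : x k t = x (k + 1) t <;> simp [hk]
    · by_cases hk : x (k - 1) t = x k t
      · left
        have := h.no_triple (k - 1) t ht0.le (by simpa using hk)
        simp only [sub_add_cancel] at this
        rw [show k - 1 + 2 = k + 1 by ring] at this
        simp [this]
      · right; simp [hk]
    · have hWl : Tendsto W (𝓝[<] t) (𝓝 (W t)) :=
        (hW.continuous.tendsto t).mono_left nhdsWithin_le_nhds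
      simp only [sub_add_cancel]
      by_cases hk : x k t = x (k + 1) t
      · have h3 : x (k - 1) t ≠ x k t := fun h' => by
          have := h.no_triple (k - 1) t ht0.le (by simpa using h')
          simp only [sub_add_cancel] at this
          rw [show k - 1 + 2 = k + 1 by ring] at this
          exact this hk
        have := ((h.exchange k t ht0 hk).1).sub hWl
        convert! this using 2
        rw [if_pos hk, if_neg h3]; ring
      · by_cases hk' : x (k - 1) t = x k t
        · have := ((h.exchange (k - 1) t ht0 (by simpa using hk')).2)
          simp only [sub_add_cancel] at this
          have := this.sub hWl
          convert! this using 2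
          rw [if_neg hk, if_pos hk']; ring
        · have := (h.no_jump k t ht0 hk' hk).sub hWl
          convert! this using 2
          rw [if_neg hk, if_neg hk']; ring
    · by_cases hk : x k t = x (k + 1) t
      · have h1 := h.velocity_le_of_collision hf ht0.le hk
        have h2 : 0 < L / N := by positivity
        simp only [hk, if_true]
        push_cast
        -- Here `y (k + 1) t - y k t = -(L / N)`, because the two particles coincide.
        nlinarith
      · simp [hk]

theorem tendsto_gap_and_velocity (h : IsElasticTrajectory N L ω α f x v) (hN : 0 < N) (hL : 0 < L)
    (hω : 0 < ω) (hα : 0 < α) (hf : LocallyIntegrable f) {w : ℝ → ℝ}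
    (hw : IsRelaxationSolution α f w) (k : ℤ) :
    Tendsto (fun t => x (k + 1) t - x k t) atTop (𝓝 (L / N)) ∧
      Tendsto (fun t => v k t - w t) atTop (𝓝 0) := by
  have hN' : (N : ℝ) ≠ 0 := by exact_mod_cast hN.ne'
  -- This makes the corrected solution start at the mean initial velocity; likewise `c` below
  -- centres the initial displacements.
  set a := (∑ k ∈ Finset.range N, v k 0) / N - w 0 with ha
  have hW := hw.add_exp hf a
  set c := (∑ k ∈ Finset.range N, (x k 0 - k * (L / N))) / N with hc
  have hchain := h.isCollidingChain hN hL hf hW c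
  obtain ⟨h1, h2⟩ := hchain.tendsto_zero hN hω hα
    (by simp [Finset.sum_sub_distrib, ha]; field_simp; ring)
    (by
      have : ∀ k ∈ Finset.range N, x k 0 - ((k : ℤ) : ℝ) * (L / N) - c -
          ∫ s in (0 : ℝ)..0, (w s + a * Real.exp (-(α * s))) = (x k 0 - k * (L / N)) - c := by
        intro k _; simp
      rw [Finset.sum_congr rfl this, Finset.sum_sub_distrib, Finset.sum_const, Finset.card_range,
        nsmul_eq_mul, hc, mul_div_cancel₀ _ hN', sub_self]) k
  constructor
  · have := h2.add_const (L / N)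
    rw [zero_add] at this
    refine this.congr fun t => ?_
    push_cast; ring
  · have hexp : Tendsto (fun t => Real.exp (-(α * t))) atTop (𝓝 0) :=
      Real.tendsto_exp_neg_atTop_nhds_zero.comp (tendsto_id.const_mul_atTop hα)
    have := h1.add (hexp.const_mul a)
    simp only [mul_zero, add_zero] at this
    refine this.congr fun t => ?_
    ring

end IsElasticTrajectory

/-! ### Uniform bounds for trigonometric kernels. -/

/-- The partial sums of the sawtooth series are uniformly bounded. -/
theorem abs_sum_sin_div_le (n : ℕ) (r : ℝ) :
    |∑ m ∈ Finset.range (n + 1), Real.sin (m * r) / m| ≤ Real.pi + 2 := by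
  -- Comparison with the Abel mean at radius `1 - 1/(n+1)`. The mean is an argument, bounded by `π`;
  -- its tail beyond `n` and the error of inserting `ρ ^ m` into the first terms are each at most
  -- `1`. The term `m = 0` vanishes since division by zero gives zero.
  set ρ : ℝ := n / (n + 1) with hρ
  have hn : (0 : ℝ) < n + 1 := by positivity
  have hρ0 : 0 ≤ ρ := by positivity
  have hρ1 : 1 - ρ = 1 / (n + 1) := by rw [hρ]; field_simp; ring
  have hρlt : ρ < 1 := by
    have : 0 < 1 / ((n : ℝ) + 1) := by positivity
    linarith
  set z : ℂ := ρ * Complex.exp (r * Complex.I) with hz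
  have hznorm : ‖z‖ < 1 := by
    rw [hz, norm_mul, Complex.norm_exp_ofReal_mul_I, Complex.norm_real, Real.norm_of_nonneg hρ0]
    simpa using hρlt
  have him : ∀ m : ℕ, (z ^ m / m).im = ρ ^ m * (Real.sin (m * r) / m) := by
    intro m
    rw [hz, mul_pow, ← Complex.exp_nat_mul, ← Complex.ofReal_pow, ← mul_assoc,
      ← Complex.ofReal_natCast m, ← Complex.ofReal_mul, Complex.div_ofReal_im,
      Complex.im_ofReal_mul, Complex.exp_ofReal_mul_I_im]
    ring
  have hs : HasSum (fun m : ℕ => ρ ^ m * (Real.sin (m * r) / m)) (-Complex.log (1 - z)).im := by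
    have := Complex.hasSum_im (Complex.hasSum_taylorSeries_neg_log hznorm)
    simpa only [him] using this
  have h1 : |(-Complex.log (1 - z)).im| ≤ Real.pi := by
    rw [Complex.neg_im, abs_neg, Complex.log_im]; exact Complex.abs_arg_le_pi _
  have hsplit := hs.summable.sum_add_tsum_nat_add (n + 1)
  rw [hs.tsum_eq] at hsplit
  have h2 : |∑' m : ℕ, ρ ^ (m + (n + 1)) *
      (Real.sin ((m + (n + 1) : ℕ) * r) / (m + (n + 1) : ℕ))| ≤ 1 := by
    have hgeo : HasSum (fun m : ℕ => ρ ^ m * (1 / (n + 1))) ((1 - ρ)⁻¹ * (1 / (n + 1))) :=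
      (hasSum_geometric_of_lt_one hρ0 hρlt).mul_right _
    have h3 := tsum_of_norm_bounded (f := fun m : ℕ => ρ ^ (m + (n + 1)) *
      (Real.sin ((m + (n + 1) : ℕ) * r) / (m + (n + 1) : ℕ))) hgeo (fun m => by
        rw [norm_mul, norm_div, Real.norm_of_nonneg (by positivity : 0 ≤ ρ ^ (m + (n + 1)))]
        have e1 : ρ ^ (m + (n + 1)) ≤ ρ ^ m := pow_le_pow_of_le_one hρ0 hρlt.le (by omega)
        have e2 : ‖((m + (n + 1) : ℕ) : ℝ)‖ = m + (n + 1) := by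
          rw [Real.norm_of_nonneg (by positivity)]; push_cast; ring
        rw [e2]
        exact mul_le_mul e1 (div_le_div₀ zero_le_one (Real.abs_sin_le_one _) hn
          (by linarith [(Nat.cast_nonneg m : (0 : ℝ) ≤ m)])) (by positivity) (by positivity))
    rw [hρ1] at h3
    simpa [hn.ne'] using h3
  have h3 : |∑ m ∈ Finset.range (n + 1), (1 - ρ ^ m) * (Real.sin (m * r) / m)| ≤ 1 := by
    have hb : ∀ m ∈ Finset.range (n + 1), |(1 - ρ ^ m) * (Real.sin (m * r) / m)| ≤ 1 / (n + 1) := by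
      intro m _
      rcases Nat.eq_zero_or_pos m with rfl | hm
      · simp; positivity
      have hm' : (0 : ℝ) < m := by exact_mod_cast hm
      have e1 : 1 - ρ ^ m ≤ m * (1 / (n + 1)) := by
        have := one_add_mul_le_pow (a := ρ - 1) (by linarith) m
        rw [add_sub_cancel] at this
        rw [← hρ1]; linarith
      have e2 : 0 ≤ 1 - ρ ^ m := sub_nonneg.2 (pow_le_one₀ hρ0 hρlt.le)
      rw [abs_mul, abs_div, abs_of_nonneg e2, abs_of_pos hm']
      calc (1 - ρ ^ m) * (|Real.sin (m * r)| / m) ≤ (m * (1 / (n + 1))) * (1 / m) := by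
            gcongr; exact Real.abs_sin_le_one _
        _ = _ := by field_simp
    refine (Finset.abs_sum_le_sum_abs _ _).trans ((Finset.sum_le_sum hb).trans ?_)
    rw [Finset.sum_const, Finset.card_range, nsmul_eq_mul]
    push_cast
    rw [mul_one_div_cancel hn.ne']
  have heq : ∑ m ∈ Finset.range (n + 1), Real.sin (m * r) / m =
      ∑ m ∈ Finset.range (n + 1), (1 - ρ ^ m) * (Real.sin (m * r) / m) +
      ∑ m ∈ Finset.range (n + 1), ρ ^ m * (Real.sin (m * r) / m) := by
    rw [← Finset.sum_add_distrib]
    exact Finset.sum_congr rfl fun m _ => by ring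
  rw [heq, abs_le]
  rw [abs_le] at h1 h2 h3
  constructor <;> linarith [h1.1, h1.2, h2.1, h2.2, h3.1, h3.2]

theorem Int.sum_Icc_neg_eq {β : Type*} [AddCommMonoid β] (g : ℤ → β) (n : ℕ) :
    ∑ m ∈ Finset.Icc (-(n : ℤ)) n, g m =
      g 0 + ∑ m ∈ Finset.range n, (g (m + 1) + g (-(m + 1))) := by
  induction n with
  | zero => simp
  | succ n ih =>
    have : Finset.Icc (-((n + 1 : ℕ) : ℤ)) (n + 1 : ℕ) =
        insert (-((n : ℤ) + 1)) (insert ((n : ℤ) + 1) (Finset.Icc (-(n : ℤ)) n)) := by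
      ext m; simp only [Finset.mem_Icc, Finset.mem_insert]; push_cast; omega
    rw [this, Finset.sum_insert (by simp; omega), Finset.sum_insert (by simp), ih,
      Finset.sum_range_succ]
    abel

/-- The symmetric partial sums of `∑ e^{imr} / (α + im)` are uniformly bounded. -/
theorem exists_norm_trigPartialSum_le {α : ℝ} (hα : 0 < α) :
    ∃ M, ∀ n r, ‖trigPartialSum (fun m => (α + Complex.I * m)⁻¹) n r‖ ≤ M := by
  set C := ∑' m : ℕ, 1 / ((m : ℝ) + 1) ^ 2 with hC
  have hsum : Summable fun m : ℕ => 1 / ((m : ℝ) + 1) ^ 2 := by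
    have := (summable_nat_add_iff 1).2 (Real.summable_one_div_nat_pow.2 (one_lt_two))
    simpa using this
  refine ⟨α⁻¹ + 2 * (Real.pi + 2) + (2 * α + 2 * α ^ 2) * C, fun n r => ?_⟩
  -- The frequencies `±m` combine to `2 (α cos mr + m sin mr) / (α² + m²)`. Writing `m / (α² + m²) =
  -- 1/m - α² / (m (α² + m²))` isolates the sawtooth series; the rest is absolutely summable.
  have hpair : ∀ m : ℕ, (α + Complex.I * ((m + 1 : ℤ) : ℂ))⁻¹ *
        Complex.exp (Complex.I * ((m + 1 : ℤ) : ℂ) * r) +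
      (α + Complex.I * ((-(m + 1) : ℤ) : ℂ))⁻¹ *
        Complex.exp (Complex.I * ((-(m + 1) : ℤ) : ℂ) * r) =
      ((2 * (Real.sin ((m + 1 : ℕ) * r) / (m + 1 : ℕ)) +
        (2 * α * Real.cos ((m + 1) * r) / (α ^ 2 + (m + 1) ^ 2) -
          2 * α ^ 2 * Real.sin ((m + 1) * r) / ((m + 1) * (α ^ 2 + (m + 1) ^ 2))) : ℝ) : ℂ) := by
    intro m
    have e1 : Complex.exp (Complex.I * ((m + 1 : ℤ) : ℂ) * r) =
        Complex.cos ((m + 1) * r) + Complex.sin ((m + 1) * r) * Complex.I := by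
      rw [← Complex.exp_mul_I]; congr 1; push_cast; ring
    have e2 : Complex.exp (Complex.I * ((-(m + 1) : ℤ) : ℂ) * r) =
        Complex.cos ((m + 1) * r) - Complex.sin ((m + 1) * r) * Complex.I := by
      have := Complex.exp_mul_I (-((m + 1 : ℂ) * r))
      rw [Complex.cos_neg, Complex.sin_neg] at this
      rw [sub_eq_add_neg, ← neg_mul, ← this]; congr 1; push_cast; ring
    have e3 : (α : ℂ) + Complex.I * (m + 1) ≠ 0 := fun h => by
      have := congrArg Complex.re h; simp at this; exact hα.ne' this
    have e4 : (α : ℂ) - Complex.I * (m + 1) ≠ 0 := fun h => by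
      have := congrArg Complex.re h; simp at this; exact hα.ne' this
    have e5 : (α : ℂ) ^ 2 + (m + 1) ^ 2 ≠ 0 := by
      have : (α : ℂ) ^ 2 + (m + 1) ^ 2 = (α + Complex.I * (m + 1)) * (α - Complex.I * (m + 1)) := by
        ring_nf; simp; ring
      rw [this]; exact mul_ne_zero e3 e4
    have e6 : (m : ℂ) + 1 ≠ 0 := Nat.cast_add_one_ne_zero m
    have e7 : ((α : ℂ) + Complex.I * (m + 1))⁻¹ =
        (α - Complex.I * (m + 1)) / (α ^ 2 + (m + 1) ^ 2) := by
      rw [inv_eq_one_div, div_eq_div_iff e3 e5]; ring_nf; simp; ring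
    have e8 : ((α : ℂ) - Complex.I * (m + 1))⁻¹ =
        (α + Complex.I * (m + 1)) / (α ^ 2 + (m + 1) ^ 2) := by
      rw [inv_eq_one_div, div_eq_div_iff e4 e5]; ring_nf; simp; ring
    rw [e1, e2]
    push_cast
    rw [show (α : ℂ) + Complex.I * (-(m + 1)) = α - Complex.I * (m + 1) by ring, e7, e8]
    field_simp
    ring_nf
    simp only [Complex.I_sq]
    ring
  rw [trigPartialSum, Int.sum_Icc_neg_eq, Finset.sum_congr rfl fun m _ => hpair m,
    ← Complex.ofReal_sum]
  refine (norm_add_le _ _).trans ?_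
  rw [add_assoc]
  refine add_le_add (by simp [abs_of_pos hα]) ?_
  rw [Complex.norm_real, Real.norm_eq_abs, Finset.sum_add_distrib]
  refine (abs_add_le _ _).trans (add_le_add ?_ ?_)
  · have h1 := abs_sum_sin_div_le n r
    rw [Finset.sum_range_succ'] at h1
    simp only [Nat.cast_zero, div_zero, add_zero] at h1
    rw [← Finset.mul_sum, abs_mul, abs_two]
    linarith
  · refine (Finset.abs_sum_le_sum_abs _ _).trans ?_
    have hb : ∀ m ∈ Finset.range n, |2 * α * Real.cos ((m + 1) * r) / (α ^ 2 + (m + 1) ^ 2) -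
        2 * α ^ 2 * Real.sin ((m + 1) * r) / ((m + 1) * (α ^ 2 + (m + 1) ^ 2))| ≤
        (2 * α + 2 * α ^ 2) * (1 / ((m : ℝ) + 1) ^ 2) := by
      intro m _
      have hm : (1 : ℝ) ≤ m + 1 := by linarith [(Nat.cast_nonneg m : (0 : ℝ) ≤ m)]
      have hm0 : (0 : ℝ) < m + 1 := by linarith
      have a1 : |2 * α * Real.cos ((m + 1) * r) / (α ^ 2 + (m + 1) ^ 2)| ≤
          2 * α * (1 / ((m : ℝ) + 1) ^ 2) := by
        rw [abs_div, abs_mul, abs_of_pos (by positivity : 0 < 2 * α),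
          abs_of_pos (by positivity : 0 < α ^ 2 + ((m : ℝ) + 1) ^ 2), mul_div_assoc]
        gcongr
        · exact Real.abs_cos_le_one _
        · nlinarith
      have a2 : |2 * α ^ 2 * Real.sin ((m + 1) * r) / ((m + 1) * (α ^ 2 + (m + 1) ^ 2))| ≤
          2 * α ^ 2 * (1 / ((m : ℝ) + 1) ^ 2) := by
        rw [abs_div, abs_mul, abs_of_pos (by positivity : 0 < 2 * α ^ 2),
          abs_of_pos (by positivity : 0 < ((m : ℝ) + 1) * (α ^ 2 + ((m : ℝ) + 1) ^ 2)),
          mul_div_assoc]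
        gcongr
        · exact Real.abs_sin_le_one _
        · nlinarith [mul_nonneg hm0.le (sq_nonneg α), sq_nonneg ((m : ℝ) + 1)]
      refine (abs_sub _ _).trans ?_
      linarith
    refine (Finset.sum_le_sum hb).trans ?_
    rw [← Finset.mul_sum]
    gcongr
    exact hsum.sum_le_tsum _ fun m _ => by positivity

/-! ### Passing from exponentials to integrable functions. -/

/-- Trigonometric polynomials on the line. -/
def trigPolynomials : Submodule ℂ (ℝ → ℂ) :=
  Submodule.span ℂ (Set.range fun (j : ℤ) (s : ℝ) => Complex.exp (Complex.I * j * s))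

theorem continuous_of_mem_trigPolynomials {p : ℝ → ℂ} (hp : p ∈ trigPolynomials) :
    Continuous p := by
  induction hp using Submodule.span_induction with
  | mem x hx => obtain ⟨j, rfl⟩ := hx; fun_prop
  | zero => exact continuous_const
  | add x y _ _ hx hy => exact hx.add hy
  | smul a x _ hx => exact hx.const_smul a

/-- Trigonometric polynomials are dense in `L¹` of a period. -/
theorem exists_trigPolynomial_integral_norm_sub_lt {g : ℝ → ℂ}
    (hg : IntervalIntegrable g volume 0 (2 * Real.pi)) {ε : ℝ} (hε : 0 < ε) :
    ∃ p ∈ trigPolynomials, ∫ s in (0 : ℝ)..(2 * Real.pi), ‖g s - p s‖ < ε := by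
  have hT : (0 : ℝ) < 2 * Real.pi := Real.two_pi_pos
  have : Fact ((0 : ℝ) < 2 * Real.pi) := ⟨hT⟩
  have : Fact ((1 : ENNReal) ≤ 1) := ⟨le_rfl⟩
  have hgm : MemLp (AddCircle.liftIoc (2 * Real.pi) 0 g) 1 AddCircle.haarAddCircle := by
    rw [memLp_haarAddCircle_iff]
    refine MemLp.memLp_liftIoc ?_
    rw [zero_add, memLp_one_iff_integrable]
    exact hg.1
  have hmk := AddCircle.measurePreserving_mk (2 * Real.pi) 0
  have hae : ∀ {P : AddCircle (2 * Real.pi) → Prop}, (∀ᵐ y ∂AddCircle.haarAddCircle, P y) →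
      ∀ᵐ s : ℝ ∂(volume.restrict (Set.Ioc (0 : ℝ) (0 + 2 * Real.pi))), P (s : AddCircle _) := by
    intro P hP
    refine hmk.quasiMeasurePreserving.ae ?_
    rw [AddCircle.volume_eq_smul_haarAddCircle]
    exact Measure.ae_smul_measure hP _
  have hmem : hgm.toLp ∈ (Submodule.span ℂ (Set.range
      (@fourierLp (2 * Real.pi) _ 1 _))).topologicalClosure := by
    rw [span_fourierLp_closure_eq_top (by simp)]; trivial
  -- Haar measure on the circle has mass one, which explains the factor `2π`.
  obtain ⟨q, hq, hdist⟩ := Metric.mem_closure_iff.1 hmem (ε / (2 * Real.pi)) (by positivity)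
  have hp : ∃ p ∈ trigPolynomials,
      ∀ᵐ s : ℝ ∂(volume.restrict (Set.Ioc (0 : ℝ) (0 + 2 * Real.pi))),
        q (s : AddCircle _) = p s := by
    clear hdist
    induction hq using Submodule.span_induction with
    | mem x hx =>
      obtain ⟨j, rfl⟩ := hx
      refine ⟨_, Submodule.subset_span ⟨j, rfl⟩, ?_⟩
      filter_upwards [hae (coeFn_fourierLp 1 j)] with s hs
      rw [hs, fourier_coe_apply]
      congr 1
      have : (Real.pi : ℂ) ≠ 0 := by exact_mod_cast Real.pi_ne_zero
      push_cast; field_simp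
    | zero =>
      refine ⟨0, zero_mem _, ?_⟩
      filter_upwards [hae (Lp.coeFn_zero ℂ 1 AddCircle.haarAddCircle)] with s hs
      rw [hs]; rfl
    | add x y _ _ hx hy =>
      obtain ⟨p1, hp1, h1⟩ := hx
      obtain ⟨p2, hp2, h2⟩ := hy
      refine ⟨_, add_mem hp1 hp2, ?_⟩
      filter_upwards [hae (Lp.coeFn_add x y), h1, h2] with s hs hs1 hs2
      rw [hs, Pi.add_apply, Pi.add_apply, hs1, hs2]
    | smul a x _ hx =>
      obtain ⟨p1, hp1, h1⟩ := hx
      refine ⟨_, Submodule.smul_mem _ a hp1, ?_⟩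
      filter_upwards [hae (Lp.coeFn_smul a x), h1] with s hs hs1
      rw [hs, Pi.smul_apply, Pi.smul_apply, hs1]
  obtain ⟨p, hpm, hpq⟩ := hp
  refine ⟨p, hpm, ?_⟩
  have h1 : ∫ s in (0 : ℝ)..(2 * Real.pi), ‖g s - p s‖ =
      ∫ y : AddCircle (2 * Real.pi), ‖(hgm.toLp : AddCircle (2 * Real.pi) → ℂ) y - q y‖ := by
    rw [← AddCircle.integral_preimage (2 * Real.pi) 0, intervalIntegral.integral_of_le hT.le,
      zero_add]
    rw [zero_add] at hpq hae
    refine integral_congr_ae ?_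
    filter_upwards [hpq, hae hgm.coeFn_toLp, ae_restrict_mem measurableSet_Ioc] with s hs1 hs2 hs3
    rw [hs2, hs1, AddCircle.liftIoc_coe_apply (by simpa using hs3)]
  have h2 : dist hgm.toLp q =
      ∫ y, ‖(hgm.toLp : AddCircle (2 * Real.pi) → ℂ) y - q y‖ ∂AddCircle.haarAddCircle := by
    rw [dist_eq_norm, L1.norm_eq_integral_norm]
    refine integral_congr_ae ?_
    filter_upwards [Lp.coeFn_sub hgm.toLp q] with y hy
    rw [hy, Pi.sub_apply]
  rw [h1, AddCircle.volume_eq_smul_haarAddCircle, integral_smul_measure, ← h2,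
    ENNReal.toReal_ofReal hT.le, smul_eq_mul]
  rw [lt_div_iff₀ hT] at hdist
  linarith

/-- Bounded kernels whose integrals against all exponentials converge have convergent integrals
against every integrable function. -/
theorem tendsto_intervalIntegral_of_forall_exp {a : ℕ → ℝ → ℂ} {b : ℝ → ℂ} {M : ℝ}
    (ham : ∀ n, Measurable (a n)) (hbm : Measurable b)
    (ha : ∀ n, ∀ s ∈ Set.uIoc 0 (2 * Real.pi), ‖a n s‖ ≤ M)
    (hb : ∀ s ∈ Set.uIoc 0 (2 * Real.pi), ‖b s‖ ≤ M)
    (hexp : ∀ j : ℤ, Tendsto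
      (fun n => ∫ s in (0 : ℝ)..(2 * Real.pi), a n s * Complex.exp (Complex.I * j * s)) atTop
      (𝓝 (∫ s in (0 : ℝ)..(2 * Real.pi), b s * Complex.exp (Complex.I * j * s))))
    {g : ℝ → ℂ} (hg : IntervalIntegrable g volume 0 (2 * Real.pi)) :
    Tendsto (fun n => ∫ s in (0 : ℝ)..(2 * Real.pi), a n s * g s) atTop
      (𝓝 (∫ s in (0 : ℝ)..(2 * Real.pi), b s * g s)) := by
  have hT : (0 : ℝ) < 2 * Real.pi := Real.two_pi_pos
  have hM : 0 ≤ M := (norm_nonneg _).trans (hb (2 * Real.pi)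
    (by rw [Set.uIoc_of_le hT.le]; simp [hT]))
  have hint : ∀ {c : ℝ → ℂ} {h : ℝ → ℂ}, Measurable c →
      (∀ s ∈ Set.uIoc 0 (2 * Real.pi), ‖c s‖ ≤ M) → IntervalIntegrable h volume 0 (2 * Real.pi) →
      IntervalIntegrable (fun s => c s * h s) volume 0 (2 * Real.pi) := by
    intro c h hcm hc hh
    rw [intervalIntegrable_iff] at hh ⊢
    exact hh.bdd_mul hcm.aestronglyMeasurable
      ((ae_restrict_iff' measurableSet_uIoc).2 (Eventually.of_forall hc))
  have hpoly : ∀ p ∈ trigPolynomials,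
      Tendsto (fun n => ∫ s in (0 : ℝ)..(2 * Real.pi), a n s * p s) atTop
      (𝓝 (∫ s in (0 : ℝ)..(2 * Real.pi), b s * p s)) := by
    intro p hp
    induction hp using Submodule.span_induction with
    | mem x hx => obtain ⟨j, rfl⟩ := hx; exact hexp j
    | zero => simp
    | add x y hx hy ihx ihy =>
      have cx := (continuous_of_mem_trigPolynomials hx).intervalIntegrable (μ := volume)
        0 (2 * Real.pi)
      have cy := (continuous_of_mem_trigPolynomials hy).intervalIntegrable (μ := volume)
        0 (2 * Real.pi)
      simp only [Pi.add_apply, mul_add]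
      rw [intervalIntegral.integral_add (hint hbm hb cx) (hint hbm hb cy)]
      refine (ihx.add ihy).congr fun n => ?_
      rw [intervalIntegral.integral_add (hint (ham n) (ha n) cx) (hint (ham n) (ha n) cy)]
    | smul c x _ ihx =>
      simp only [Pi.smul_apply, smul_eq_mul, mul_left_comm _ c, intervalIntegral.integral_const_mul]
      exact ihx.const_mul c
  rw [Metric.tendsto_atTop]
  intro ε hε
  -- Replacing `g` by `p` costs at most `ε / 4` for each kernel, uniformly in `n`; `M + 1` avoids
  -- dividing by zero.
  obtain ⟨p, hp, hpε⟩ := exists_trigPolynomial_integral_norm_sub_lt hg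
    (ε := ε / (4 * (M + 1))) (by positivity)
  obtain ⟨n₀, hn₀⟩ := Metric.tendsto_atTop.1 (hpoly p hp) (ε / 2) (by positivity)
  have hpi := (continuous_of_mem_trigPolynomials hp).intervalIntegrable (μ := volume)
    0 (2 * Real.pi)
  have hclose : ∀ {c : ℝ → ℂ}, Measurable c → (∀ s ∈ Set.uIoc 0 (2 * Real.pi), ‖c s‖ ≤ M) →
      dist (∫ s in (0 : ℝ)..(2 * Real.pi), c s * g s) (∫ s in (0 : ℝ)..(2 * Real.pi), c s * p s) ≤
        ε / 4 := by
    intro c hcm hc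
    rw [dist_eq_norm, ← intervalIntegral.integral_sub (hint hcm hc hg) (hint hcm hc hpi)]
    have h1 : ‖∫ s in (0 : ℝ)..(2 * Real.pi), (c s * g s - c s * p s)‖ ≤
        ∫ s in (0 : ℝ)..(2 * Real.pi), M * ‖g s - p s‖ := by
      refine intervalIntegral.norm_integral_le_of_norm_le hT.le
        (Eventually.of_forall fun s hs => ?_) ((hg.sub hpi).norm.const_mul M)
      rw [← mul_sub, norm_mul]
      refine mul_le_mul_of_nonneg_right (hc s ?_) (norm_nonneg _)
      rwa [Set.uIoc_of_le hT.le]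
    rw [intervalIntegral.integral_const_mul] at h1
    refine h1.trans ?_
    calc M * ∫ s in (0 : ℝ)..(2 * Real.pi), ‖g s - p s‖ ≤ (M + 1) * (ε / (4 * (M + 1))) :=
          mul_le_mul (by linarith) hpε.le (intervalIntegral.integral_nonneg hT.le
            fun _ _ => norm_nonneg _) (by linarith)
      _ = ε / 4 := by field_simp
  refine ⟨n₀, fun n hn => ?_⟩
  have h1 := hclose (ham n) (ha n)
  have h2 := hclose hbm hb
  rw [dist_comm] at h2
  have h3 := hn₀ n hn
  have := dist_triangle4 (∫ s in (0 : ℝ)..(2 * Real.pi), a n s * g s)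
    (∫ s in (0 : ℝ)..(2 * Real.pi), a n s * p s) (∫ s in (0 : ℝ)..(2 * Real.pi), b s * p s)
    (∫ s in (0 : ℝ)..(2 * Real.pi), b s * g s)
  linarith

/-! ### The periodic solution and its Fourier series. -/

/-- The kernel of the periodic solution operator of `w' = f - α w`. -/
noncomputable def periodicKernel (α t s : ℝ) : ℂ :=
  ((Real.exp (-(α * (t - s))) *
    ((if s ≤ t then 1 else 0) + (Real.exp (2 * Real.pi * α) - 1)⁻¹) : ℝ) : ℂ)

theorem measurable_periodicKernel (α t : ℝ) : Measurable (periodicKernel α t) := by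
  unfold periodicKernel
  refine Complex.measurable_ofReal.comp (Measurable.mul (by fun_prop)
    (Measurable.add ?_ (by fun_prop)))
  exact Measurable.ite measurableSet_Iic measurable_const measurable_const

theorem exp_two_pi_mul_sub_one_pos {α : ℝ} (hα : 0 < α) : 0 < Real.exp (2 * Real.pi * α) - 1 := by
  have : 0 < 2 * Real.pi * α := by positivity
  linarith [Real.add_one_lt_exp this.ne']

theorem norm_periodicKernel_le {α t s : ℝ} (hα : 0 < α) (ht : 0 ≤ t) (hs : s ≤ 2 * Real.pi) :
    ‖periodicKernel α t s‖ ≤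
      Real.exp (2 * Real.pi * α) * (1 + (Real.exp (2 * Real.pi * α) - 1)⁻¹) := by
  have hκ := exp_two_pi_mul_sub_one_pos hα
  have h1 : 0 ≤ (if s ≤ t then (1 : ℝ) else 0) := by split_ifs <;> norm_num
  have h2 : (if s ≤ t then (1 : ℝ) else 0) ≤ 1 := by split_ifs <;> norm_num
  rw [periodicKernel, Complex.norm_real, Real.norm_of_nonneg (by positivity)]
  gcongr
  nlinarith

theorem intervalIntegral_periodicKernel {α t : ℝ} (ht : t ∈ Set.Icc 0 (2 * Real.pi)) {g : ℝ → ℂ}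
    (hg : IntervalIntegrable g volume 0 (2 * Real.pi)) :
    ∫ s in (0 : ℝ)..(2 * Real.pi), periodicKernel α t s * g s =
      (Real.exp (-(α * t)) : ℂ) * ((∫ s in (0 : ℝ)..t, (Real.exp (α * s) : ℂ) * g s) +
        ((Real.exp (2 * Real.pi * α) - 1)⁻¹ : ℝ) *
          ∫ s in (0 : ℝ)..(2 * Real.pi), (Real.exp (α * s) : ℂ) * g s) := by
  set κ : ℝ := (Real.exp (2 * Real.pi * α) - 1)⁻¹ with hκ
  have hT : (0 : ℝ) ≤ 2 * Real.pi := Real.two_pi_pos.le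
  have hsub1 : Set.uIcc 0 t ⊆ Set.uIcc 0 (2 * Real.pi) := by
    rw [Set.uIcc_of_le ht.1, Set.uIcc_of_le hT]; exact Set.Icc_subset_Icc_right ht.2
  have hsub2 : Set.uIcc t (2 * Real.pi) ⊆ Set.uIcc 0 (2 * Real.pi) := by
    rw [Set.uIcc_of_le ht.2, Set.uIcc_of_le hT]; exact Set.Icc_subset_Icc_left ht.1
  have hexp : ∀ a b, IntervalIntegrable g volume a b →
      IntervalIntegrable (fun s => (Real.exp (α * s) : ℂ) * g s) volume a b := fun a b h =>
    h.continuousOn_mul (by fun_prop)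
  have e1 := hexp _ _ (hg.mono_set hsub1)
  have e2 := hexp _ _ (hg.mono_set hsub2)
  have hsplit : ∀ s, (Real.exp (-(α * (t - s))) : ℂ) =
      (Real.exp (-(α * t)) : ℂ) * (Real.exp (α * s) : ℂ) := fun s => by
    rw [← Complex.ofReal_mul, ← Real.exp_add]; congr 2; ring
  have c1 : Set.EqOn (fun s => periodicKernel α t s * g s) (fun s => ((1 + κ : ℝ) *
      (Real.exp (-(α * t)) : ℂ)) * ((Real.exp (α * s) : ℂ) * g s)) (Set.uIoc 0 t) := by
    intro s hs
    rw [Set.uIoc_of_le ht.1] at hs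
    simp only [periodicKernel, if_pos hs.2]
    rw [Complex.ofReal_mul, hsplit]; ring
  have c2 : Set.EqOn (fun s => periodicKernel α t s * g s) (fun s => (κ *
      (Real.exp (-(α * t)) : ℂ)) * ((Real.exp (α * s) : ℂ) * g s)) (Set.uIoc t (2 * Real.pi)) := by
    intro s hs
    rw [Set.uIoc_of_le ht.2] at hs
    simp only [periodicKernel, if_neg (not_le.2 hs.1)]
    rw [Complex.ofReal_mul, hsplit, zero_add]; ring
  rw [← intervalIntegral.integral_add_adjacent_intervals
      ((e1.const_mul _).congr c1.symm) ((e2.const_mul _).congr c2.symm),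
    ← intervalIntegral.integral_add_adjacent_intervals e1 e2,
    intervalIntegral.integral_congr_ae (Eventually.of_forall fun s hs => c1 hs),
    intervalIntegral.integral_congr_ae (Eventually.of_forall fun s hs => c2 hs),
    intervalIntegral.integral_const_mul, intervalIntegral.integral_const_mul]
  push_cast; ring

theorem ofReal_add_I_mul_ne_zero {α : ℝ} (hα : 0 < α) (u : ℝ) : (α : ℂ) + Complex.I * u ≠ 0 :=
  fun h => by
    have := congrArg Complex.re h
    simp at this
    exact hα.ne' this

/-- The periodic solution operator multiplies `e^{ijt}` by `(α + ij)⁻¹`, since `e^{(α + ij) 2π} =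
e^{2πα}`. -/
theorem intervalIntegral_periodicKernel_exp {α t : ℝ} (hα : 0 < α)
    (ht : t ∈ Set.Icc 0 (2 * Real.pi)) (j : ℤ) :
    ∫ s in (0 : ℝ)..(2 * Real.pi), periodicKernel α t s * Complex.exp (Complex.I * j * s) =
      (α + Complex.I * j)⁻¹ * Complex.exp (Complex.I * j * t) := by
  have hne : (α : ℂ) + Complex.I * j ≠ 0 := by
    have := ofReal_add_I_mul_ne_zero hα j; exact_mod_cast this
  rw [intervalIntegral_periodicKernel ht
    (Continuous.intervalIntegrable (by fun_prop) _ _)]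
  have hint : ∀ b : ℝ, ∫ s in (0 : ℝ)..b,
      (Real.exp (α * s) : ℂ) * Complex.exp (Complex.I * j * s) =
      (Complex.exp ((α + Complex.I * j) * b) - 1) / (α + Complex.I * j) := by
    intro b
    have : ∀ s : ℝ, (Real.exp (α * s) : ℂ) * Complex.exp (Complex.I * j * s) =
        Complex.exp ((α + Complex.I * j) * s) := fun s => by
      rw [Complex.ofReal_exp, ← Complex.exp_add]; congr 1; push_cast; ring
    simp only [this]
    rw [integral_exp_mul_complex hne]
    simp
  have h2pi : Complex.exp ((α + Complex.I * j) * (2 * Real.pi : ℝ)) =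
      (Real.exp (2 * Real.pi * α) : ℂ) := by
    rw [Complex.ofReal_exp, Complex.exp_eq_exp_iff_exists_int]
    exact ⟨j, by push_cast; ring⟩
  have hκ : ((Real.exp (2 * Real.pi * α) : ℂ) - 1) ≠ 0 := by
    have := (exp_two_pi_mul_sub_one_pos hα).ne'
    exact_mod_cast this
  have hsplit : Complex.exp ((α + Complex.I * j) * t) =
      Complex.exp (α * t) * Complex.exp (Complex.I * j * t) := by
    rw [← Complex.exp_add]; congr 1; ring
  have hinv : Complex.exp (-(α * t)) * Complex.exp (α * t) = 1 := by
    rw [← Complex.exp_add]; simp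
  rw [hint, hint, h2pi, hsplit]
  push_cast at hκ ⊢
  rw [mul_div_assoc', inv_mul_cancel₀ hκ, ← add_div, sub_add_cancel, mul_div_assoc', ← mul_assoc,
    hinv]
  field_simp

/-- Partial sums are convolutions, so convergence of a series at `t` becomes convergence of kernels
tested against `g`. -/
theorem intervalIntegral_trigPartialSum_mul {b : ℤ → ℂ} {g : ℝ → ℂ}
    (hg : IntervalIntegrable g volume 0 (2 * Real.pi)) (n : ℕ) (t : ℝ) :
    ∫ s in (0 : ℝ)..(2 * Real.pi), ((2 * (Real.pi : ℂ))⁻¹ * trigPartialSum b n (t - s)) * g s =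
      trigPartialSum (fun m => ((2 * (Real.pi : ℂ))⁻¹ *
        ∫ s in (0 : ℝ)..(2 * Real.pi), g s * Complex.exp (-(Complex.I * m * s))) * b m) n t := by
  have hterm : ∀ s : ℝ, ((2 * (Real.pi : ℂ))⁻¹ * trigPartialSum b n (t - s)) * g s =
      ∑ m ∈ Finset.Icc (-(n : ℤ)) n, ((2 * (Real.pi : ℂ))⁻¹ * b m *
        Complex.exp (Complex.I * m * t)) * (g s * Complex.exp (-(Complex.I * m * s))) := by
    intro s
    rw [trigPartialSum, Finset.mul_sum, Finset.sum_mul]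
    refine Finset.sum_congr rfl fun m _ => ?_
    have : Complex.exp (Complex.I * m * ((t - s : ℝ) : ℂ)) =
        Complex.exp (Complex.I * m * t) * Complex.exp (-(Complex.I * m * s)) := by
      rw [← Complex.exp_add]; congr 1; push_cast; ring
    push_cast at this ⊢
    rw [this]; ring
  simp only [hterm]
  rw [intervalIntegral.integral_finsetSum]
  · rw [trigPartialSum]
    refine Finset.sum_congr rfl fun m _ => ?_
    rw [intervalIntegral.integral_const_mul]; ring
  · intro m _
    exact (hg.mul_continuousOn (by fun_prop)).const_mul _

theorem integral_exp_mul_exp_neg (j m : ℤ) :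
    (2 * (Real.pi : ℂ))⁻¹ * ∫ s in (0 : ℝ)..(2 * Real.pi),
      Complex.exp (Complex.I * j * s) * Complex.exp (-(Complex.I * m * s)) =
      if m = j then 1 else 0 := by
  have hpi : (Real.pi : ℂ) ≠ 0 := by exact_mod_cast Real.pi_ne_zero
  split_ifs with h
  · subst h
    have : ∀ s : ℝ, Complex.exp (Complex.I * m * s) * Complex.exp (-(Complex.I * m * s)) = 1 :=
      fun s => by rw [← Complex.exp_add]; simp
    simp only [this]
    simp
    field_simp
  · have hne : Complex.I * ((j - m : ℤ) : ℂ) ≠ 0 :=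
      mul_ne_zero Complex.I_ne_zero (by exact_mod_cast sub_ne_zero.2 (Ne.symm h))
    have : ∀ s : ℝ, Complex.exp (Complex.I * j * s) * Complex.exp (-(Complex.I * m * s)) =
        Complex.exp ((Complex.I * ((j - m : ℤ) : ℂ)) * s) :=
      fun s => by rw [← Complex.exp_add]; congr 1; push_cast; ring
    simp only [this]
    rw [integral_exp_mul_complex hne]
    have h1 : Complex.exp (Complex.I * ((j - m : ℤ) : ℂ) * ((2 * Real.pi : ℝ) : ℂ)) = 1 :=
      Complex.exp_eq_one_iff.2 ⟨j - m, by push_cast; ring⟩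
    rw [h1]; simp

/-- For a locally integrable periodic force the equation `w' = f - α w` has a periodic solution,
whose Fourier series converges to it at every point. -/
theorem exists_periodic_isRelaxationSolution {α : ℝ} (hα : 0 < α) {f : ℝ → ℝ}
    (hf : LocallyIntegrable f) (hper : Function.Periodic f (2 * Real.pi)) :
    ∃ w : ℝ → ℝ, IsRelaxationSolution α f w ∧ Function.Periodic w (2 * Real.pi) ∧
      ∀ t, Tendsto
        (fun n => trigPartialSum (fun m => fourierCoefficient f m / (α + Complex.I * m)) n t)
        atTop (𝓝 (w t : ℂ)) := by
  have hT : (0 : ℝ) < 2 * Real.pi := Real.two_pi_pos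
  have hfi : ∀ a b, IntervalIntegrable f volume a b := fun a b =>
    (hf.integrableOn_isCompact isCompact_uIcc).intervalIntegrable
  have hfc : IntervalIntegrable (fun s => (f s : ℂ)) volume 0 (2 * Real.pi) :=
    ⟨(hfi _ _).1.ofReal, (hfi _ _).2.ofReal⟩
  have hfe : ∀ a b, IntervalIntegrable (fun s => Real.exp (α * s) * f s) volume a b := fun a b =>
    (hfi a b).continuousOn_mul (by fun_prop)
  set Φ : ℝ → ℝ := fun t => ∫ s in (0 : ℝ)..t, Real.exp (α * s) * f s with hΦ
  -- The value for which `w (2π) = w 0`; it equals `∑_{j ≥ 1} e^{-2πjα}`, the weight of all earlier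
  -- periods.
  set κ : ℝ := (Real.exp (2 * Real.pi * α) - 1)⁻¹ with hκ
  have hκpos := exp_two_pi_mul_sub_one_pos hα
  set w : ℝ → ℝ := fun t => Real.exp (-(α * t)) * (κ * Φ (2 * Real.pi) + Φ t) with hw
  have hwper : Function.Periodic w (2 * Real.pi) := by
    intro t
    have h1 : Φ (t + 2 * Real.pi) = Φ (2 * Real.pi) + Real.exp (2 * Real.pi * α) * Φ t := by
      simp only [hΦ]
      rw [← intervalIntegral.integral_add_adjacent_intervals (hfe 0 (2 * Real.pi)) (hfe _ _),
        ← intervalIntegral.integral_const_mul]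
      congr 1
      have := intervalIntegral.integral_comp_add_right (a := 0) (b := t)
        (fun s => Real.exp (α * s) * f s) (2 * Real.pi)
      rw [zero_add] at this
      rw [← this]
      refine intervalIntegral.integral_congr fun s _ => ?_
      simp only [hper s]
      rw [← mul_assoc, ← Real.exp_add]; congr 2; ring
    have h2 : Real.exp (-(α * (t + 2 * Real.pi))) =
        Real.exp (-(α * t)) * (Real.exp (2 * Real.pi * α))⁻¹ := by
      rw [← Real.exp_neg, ← Real.exp_add]; congr 1; ring
    simp only [hw]
    rw [h1, h2]
    have hE := (Real.exp_pos (2 * Real.pi * α)).ne'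
    have hκE : κ * Real.exp (2 * Real.pi * α) = κ + 1 := by
      have : κ * (Real.exp (2 * Real.pi * α) - 1) = 1 := inv_mul_cancel₀ hκpos.ne'
      linarith
    rw [mul_assoc]
    congr 1
    rw [inv_mul_eq_iff_eq_mul₀ hE]
    linear_combination (-Φ (2 * Real.pi)) * hκE
  refine ⟨w, isRelaxationSolution_duhamel α hf _, hwper, ?_⟩
  obtain ⟨M, hM⟩ := exists_norm_trigPartialSum_le hα
  have main : ∀ t ∈ Set.Icc 0 (2 * Real.pi), Tendsto
      (fun n => trigPartialSum (fun m => fourierCoefficient f m / (α + Complex.I * m)) n t)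
      atTop (𝓝 (w t : ℂ)) := by
    intro t ht
    set b : ℤ → ℂ := fun m => (α + Complex.I * m)⁻¹ with hb
    have hcont : ∀ n, Continuous (trigPartialSum b n) := fun n => by
      unfold trigPartialSum; fun_prop
    have hlim := tendsto_intervalIntegral_of_forall_exp
      (a := fun n s => (2 * (Real.pi : ℂ))⁻¹ * trigPartialSum b n (t - s))
      (b := periodicKernel α t) (g := fun s => (f s : ℂ))
      (M := max (‖(2 * (Real.pi : ℂ))⁻¹‖ * M)
        (Real.exp (2 * Real.pi * α) * (1 + (Real.exp (2 * Real.pi * α) - 1)⁻¹)))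
      (fun n => (continuous_const.mul ((hcont n).comp (by fun_prop))).measurable)
      (measurable_periodicKernel α t)
      (fun n s _ => by
        refine le_max_of_le_left ?_
        rw [norm_mul]
        exact mul_le_mul_of_nonneg_left (hM n _) (norm_nonneg _))
      (fun s hs => by
        rw [Set.uIoc_of_le hT.le] at hs
        exact le_max_of_le_right (norm_periodicKernel_le hα ht.1 hs.2))
      (fun j => by
        rw [intervalIntegral_periodicKernel_exp hα ht]
        refine tendsto_const_nhds.congr' ?_
        -- Once `n ≥ |j|`, orthogonality leaves exactly the term `m = j`, so the sequence is
        -- eventually constant.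
        filter_upwards [eventually_ge_atTop j.natAbs] with n hn
        rw [intervalIntegral_trigPartialSum_mul (Continuous.intervalIntegrable (by fun_prop) _ _),
          trigPartialSum, Finset.sum_eq_single j]
        · rw [integral_exp_mul_exp_neg, if_pos rfl, one_mul]
        · intro m _ hmj
          rw [integral_exp_mul_exp_neg, if_neg hmj]; simp
        · intro hj
          exact absurd (Finset.mem_Icc.2 ⟨by omega, by omega⟩) hj)
      hfc
    have hwt : (w t : ℂ) = ∫ s in (0 : ℝ)..(2 * Real.pi), periodicKernel α t s * (f s : ℂ) := by
      rw [intervalIntegral_periodicKernel ht hfc]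
      simp only [← Complex.ofReal_mul, intervalIntegral.integral_ofReal, hw, hΦ, hκ]
      push_cast; ring
    rw [hwt]
    refine hlim.congr fun n => ?_
    rw [intervalIntegral_trigPartialSum_mul hfc]
    rfl
  intro t
  obtain ⟨j, hj, -⟩ := existsUnique_add_zsmul_mem_Ico hT t 0
  rw [zero_add] at hj
  have hsum : ∀ n, Function.Periodic (trigPartialSum
      (fun m => fourierCoefficient f m / (α + Complex.I * m)) n) (2 * Real.pi) := by
    intro n s
    unfold trigPartialSum
    refine Finset.sum_congr rfl fun m _ => ?_
    congr 1
    rw [Complex.exp_eq_exp_iff_exists_int]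
    exact ⟨m, by push_cast; ring⟩
  rw [← (hwper.zsmul j) t]
  refine (main _ ⟨hj.1, hj.2.le⟩).congr fun n => ?_
  exact (hsum n).zsmul j t

/-! ### Averages of families bounded in `L²`. -/

section Averaging

variable {X R 𝕜 : Type*} [MeasurableSpace X] [MeasurableSpace R] [RCLike 𝕜]
  {μ : Measure X} {ν : Measure R} {F : R → X → 𝕜} {C : ENNReal}

/-- Cauchy–Schwarz in `x`, uniformly in `r`; this is the integrability needed for every use of
Fubini below. -/
theorem integrable_prod_of_eLpNorm_le [SFinite μ] [IsFiniteMeasure ν]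
    (hF : Measurable (Function.uncurry F)) (hC : C ≠ ⊤) (hFC : ∀ r, eLpNorm (F r) 2 μ ≤ C)
    {g : X → 𝕜} (hg : MemLp g 2 μ) :
    Integrable (fun z : X × R => g z.1 * F z.2 z.1) (μ.prod ν) := by
  have hFm : Measurable fun z : X × R => F z.2 z.1 := hF.comp measurable_swap
  have hm : AEStronglyMeasurable (fun z : X × R => g z.1 * F z.2 z.1) (μ.prod ν) :=
    hg.aestronglyMeasurable.comp_fst.mul hFm.aestronglyMeasurable
  refine ⟨hm, ?_⟩
  rw [hasFiniteIntegral_iff_enorm, lintegral_prod_symm _ hm.enorm]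
  have hbd : ∀ r, ∫⁻ x, ‖g x * F r x‖ₑ ∂μ ≤ eLpNorm g 2 μ * C := by
    intro r
    have hFr : Measurable (F r) := hF.of_uncurry_left
    have h1 := eLpNorm_smul_le_mul_eLpNorm (p := 2) (q := 2) (r := 1) (μ := μ)
      hFr.aestronglyMeasurable hg.aestronglyMeasurable
    rw [eLpNorm_one_eq_lintegral_enorm] at h1
    simp only [Pi.smul_apply', smul_eq_mul] at h1
    exact h1.trans (by gcongr; exact hFC r)
  refine (lintegral_mono hbd).trans_lt ?_
  rw [lintegral_const]
  exact ENNReal.mul_lt_top (ENNReal.mul_lt_top hg.eLpNorm_lt_top hC.lt_top) (measure_lt_top _ _)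

theorem eLpNorm_two_sq_eq_lintegral (f : X → 𝕜) :
    eLpNorm f 2 μ ^ 2 = ∫⁻ x, ‖f x‖ₑ ^ 2 ∂μ := by
  have := eLpNorm_nnreal_pow_eq_lintegral (p := 2) (f := f) (μ := μ) two_ne_zero
  simpa using this

theorem stronglyMeasurable_integral_param [SFinite ν] (hF : Measurable (Function.uncurry F)) :
    StronglyMeasurable fun x => ∫ r, F r x ∂ν := by
  have hFm : Measurable fun z : X × R => F z.2 z.1 := hF.comp measurable_swap
  exact StronglyMeasurable.integral_prod_right (f := fun x r => F r x) hFm.stronglyMeasurable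

theorem memLp_integral_of_eLpNorm_le [SFinite μ] [IsProbabilityMeasure ν]
    (hF : Measurable (Function.uncurry F)) (hC : C ≠ ⊤) (hFC : ∀ r, eLpNorm (F r) 2 μ ≤ C) :
    MemLp (fun x => ∫ r, F r x ∂ν) 2 μ := by
  have hFm : Measurable fun z : X × R => F z.2 z.1 := hF.comp measurable_swap
  refine ⟨(stronglyMeasurable_integral_param hF).aestronglyMeasurable, ?_⟩
  have h1 : ∀ x, ‖∫ r, F r x ∂ν‖ₑ ^ 2 ≤ ∫⁻ r, ‖F r x‖ₑ ^ 2 ∂ν := by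
    intro x
    have hm : AEStronglyMeasurable (fun r => F r x) ν := hF.of_uncurry_right.aestronglyMeasurable
    rw [← eLpNorm_two_sq_eq_lintegral]
    gcongr
    refine (enorm_integral_le_lintegral_enorm _).trans ?_
    rw [← eLpNorm_one_eq_lintegral_enorm]
    exact eLpNorm_le_eLpNorm_of_exponent_le (by norm_num) hm
  have h2 : eLpNorm (fun x => ∫ r, F r x ∂ν) 2 μ ^ 2 ≤ C ^ 2 := by
    rw [eLpNorm_two_sq_eq_lintegral]
    calc ∫⁻ x, ‖∫ r, F r x ∂ν‖ₑ ^ 2 ∂μ ≤ ∫⁻ x, ∫⁻ r, ‖F r x‖ₑ ^ 2 ∂ν ∂μ := lintegral_mono h1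
      _ = ∫⁻ r, ∫⁻ x, ‖F r x‖ₑ ^ 2 ∂μ ∂ν :=
        lintegral_lintegral_swap (hFm.enorm.pow_const 2).aemeasurable
      _ ≤ ∫⁻ _r, C ^ 2 ∂ν := lintegral_mono fun r => by
        rw [← eLpNorm_two_sq_eq_lintegral]; gcongr; exact hFC r
      _ = C ^ 2 := by simp
  have h3 : eLpNorm (fun x => ∫ r, F r x ∂ν) 2 μ ≤ C :=
    (ENNReal.pow_le_pow_left_iff two_ne_zero).1 h2
  exact h3.trans_lt hC.lt_top

theorem inner_toLp_toLp {f g : X → 𝕜} (hf : MemLp f 2 μ) (hg : MemLp g 2 μ) :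
    inner 𝕜 hf.toLp hg.toLp = ∫ x, starRingEnd 𝕜 (f x) * g x ∂μ := by
  rw [L2.inner_def]
  refine integral_congr_ae ?_
  filter_upwards [hf.coeFn_toLp, hg.coeFn_toLp] with x h1 h2
  rw [h1, h2, RCLike.inner_apply, mul_comm]

/-- Fubini: averaging commutes with inner products, so no vector-valued integral in `L²` is needed.
-/
theorem inner_toLp_integral [SFinite μ] [IsProbabilityMeasure ν]
    (hF : Measurable (Function.uncurry F)) (hC : C ≠ ⊤) (hFC : ∀ r, eLpNorm (F r) 2 μ ≤ C)
    (hFL : ∀ r, MemLp (F r) 2 μ) (A : Lp 𝕜 2 μ) :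
    inner 𝕜 A (memLp_integral_of_eLpNorm_le (ν := ν) hF hC hFC).toLp =
      ∫ r, inner 𝕜 A (hFL r).toLp ∂ν := by
  have hA : MemLp (fun x => starRingEnd 𝕜 (A x)) 2 μ := (Lp.memLp A).star
  have hprod := integrable_prod_of_eLpNorm_le (ν := ν) hF hC hFC hA
  have h1 : ∀ {g : X → 𝕜} (hg : MemLp g 2 μ),
      inner 𝕜 A hg.toLp = ∫ x, starRingEnd 𝕜 (A x) * g x ∂μ := fun hg => by
    conv_lhs => rw [← Lp.toLp_coeFn A (Lp.memLp A)]
    exact inner_toLp_toLp (Lp.memLp A) hg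
  simp only [h1]
  rw [← integral_integral_swap hprod]
  simp only [integral_const_mul]

end Averaging

/-! ### The exponential weight. -/

/-- The law of an exponential random variable with rate `α`, as a weighted Lebesgue measure. -/
noncomputable def expWeight (α : ℝ) : Measure ℝ :=
  (volume.restrict (Set.Ioi 0)).withDensity fun r => ENNReal.ofReal (α * Real.exp (-(α * r)))

theorem integral_expWeight {E : Type*} [NormedAddCommGroup E] [NormedSpace ℝ E] {α : ℝ}
    (hα : 0 < α) (g : ℝ → E) :
    ∫ r, g r ∂expWeight α = ∫ r in Set.Ioi 0, (α * Real.exp (-(α * r))) • g r := by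
  rw [expWeight, integral_withDensity_eq_integral_toReal_smul (by fun_prop) (by simp)]
  refine integral_congr_ae (Eventually.of_forall fun r => ?_)
  simp only
  rw [ENNReal.toReal_ofReal (by positivity)]

theorem integrableOn_exp_neg_mul {α : ℝ} (hα : 0 < α) :
    IntegrableOn (fun r => α * Real.exp (-(α * r))) (Set.Ioi 0) := by
  have := (integrableOn_exp_mul_Ioi (a := -α) (by linarith) 0).const_mul α
  simpa only [neg_mul, IntegrableOn] using this

theorem isProbabilityMeasure_expWeight {α : ℝ} (hα : 0 < α) :
    IsProbabilityMeasure (expWeight α) := by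
  constructor
  rw [expWeight, withDensity_apply _ MeasurableSet.univ, Measure.restrict_univ,
    ← ofReal_integral_eq_lintegral_ofReal (integrableOn_exp_neg_mul hα)
      (Eventually.of_forall fun r => by positivity)]
  have h := integral_exp_mul_Ioi (a := -α) (by linarith) 0
  simp only [neg_mul] at h
  rw [integral_const_mul, h]
  simp [hα.ne']

theorem integral_exp_expWeight {α : ℝ} (hα : 0 < α) (t u : ℝ) :
    ∫ r, Complex.exp (Complex.I * (t - r : ℝ) * u) ∂expWeight α =
      α * (Complex.exp (Complex.I * t * u) * (α + Complex.I * u)⁻¹) := by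
  have hne := ofReal_add_I_mul_ne_zero hα u
  rw [integral_expWeight hα]
  have h1 : ∀ r : ℝ, (α * Real.exp (-(α * r))) • Complex.exp (Complex.I * (t - r : ℝ) * u) =
      (α * Complex.exp (Complex.I * t * u)) * Complex.exp (-(α + Complex.I * u) * r) := by
    intro r
    rw [Complex.real_smul, Complex.ofReal_mul, Complex.ofReal_exp, mul_assoc, mul_assoc,
      ← Complex.exp_add, mul_assoc, ← Complex.exp_add]
    congr 2; push_cast; ring
  simp only [h1]
  rw [integral_const_mul, integral_exp_mul_complex_Ioi (by simpa using hα), neg_div_neg_eq,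
    Complex.ofReal_zero, mul_zero, Complex.exp_zero]
  ring

/-! ### Orthogonal random measures and their integrals. -/

section OrthogonalMeasure

variable {Ω : Type*} [MeasurableSpace Ω] {P : Measure Ω} {Z : VectorMeasure ℝ (Lp ℂ 2 P)}
  {G : Measure ℝ}

theorem IsOrthogonalMeasure.isFiniteMeasure (h : IsOrthogonalMeasure P Z G) : IsFiniteMeasure G :=
  ⟨by rw [h.structure_measure _ MeasurableSet.univ]; exact ENNReal.ofReal_lt_top⟩

/-- Splitting both sets along `A ∩ B`, orthogonality kills everything but the common part. -/
theorem IsOrthogonalMeasure.inner_eq (h : IsOrthogonalMeasure P Z G) {A B : Set ℝ}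
    (hA : MeasurableSet A) (hB : MeasurableSet B) : inner ℂ (Z A) (Z B) = G.real (A ∩ B) := by
  have hA' : Z A = Z (A ∩ B) + Z (A \ B) := by
    rw [← Z.of_union (Set.disjoint_sdiff_right.mono_left Set.inter_subset_right)
      (hA.inter hB) (hA.diff hB), Set.inter_union_sdiff]
  have hB' : Z B = Z (A ∩ B) + Z (B \ A) := by
    rw [← Z.of_union (Set.disjoint_sdiff_right.mono_left Set.inter_subset_left)
      (hA.inter hB) (hB.diff hA), Set.inter_comm, Set.inter_union_sdiff]
  have e1 : inner ℂ (Z (A \ B)) (Z (A ∩ B)) = 0 := h.orthogonal _ _ (hA.diff hB) (hA.inter hB)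
    (Set.disjoint_sdiff_left.mono_right Set.inter_subset_right)
  have e2 : inner ℂ (Z (A ∩ B)) (Z (B \ A)) = 0 := h.orthogonal _ _ (hA.inter hB) (hB.diff hA)
    (Set.disjoint_sdiff_right.mono_left Set.inter_subset_left)
  have e3 : inner ℂ (Z (A \ B)) (Z (B \ A)) = 0 := h.orthogonal _ _ (hA.diff hB) (hB.diff hA)
    (Set.disjoint_sdiff_left.mono_right Set.sdiff_subset)
  rw [hA', hB', inner_add_left, inner_add_right, inner_add_right, e1, e2, e3,
    inner_self_eq_norm_sq_to_K, Measure.real, h.structure_measure _ (hA.inter hB),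
    ENNReal.toReal_ofReal (by positivity)]
  simp

theorem memLp_simpleFunc [IsFiniteMeasure G] (φ : SimpleFunc ℝ ℂ) : MemLp φ 2 G :=
  φ.memLp_of_isFiniteMeasure 2 G

theorem toLp_simpleFunc_eq_sum [IsFiniteMeasure G] (φ : SimpleFunc ℝ ℂ) :
    (memLp_simpleFunc (G := G) φ).toLp = ∑ c ∈ φ.range,
      c • indicatorConstLp 2 (φ.measurableSet_preimage {c}) (measure_ne_top G _) (1 : ℂ) := by
  apply Lp.ext
  refine (memLp_simpleFunc φ).coeFn_toLp.trans ?_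
  refine EventuallyEq.trans ?_ (Lp.coeFn_finsetSum _ _).symm
  have hterm : ∀ᵐ u ∂G, ∀ c ∈ φ.range, (c • indicatorConstLp 2 (φ.measurableSet_preimage {c})
      (measure_ne_top G _) (1 : ℂ)) u = (φ ⁻¹' {c}).indicator (fun _ => c) u := by
    rw [eventually_all_finset]
    intro c _
    filter_upwards [Lp.coeFn_smul c (indicatorConstLp 2 (φ.measurableSet_preimage {c})
      (measure_ne_top G _) (1 : ℂ)), indicatorConstLp_coeFn (p := 2)
        (hs := φ.measurableSet_preimage {c}) (hμs := measure_ne_top G _) (c := (1 : ℂ))]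
      with u h1 h2
    rw [h1, Pi.smul_apply, h2]
    by_cases hu : u ∈ φ ⁻¹' {c} <;> simp [hu]
  filter_upwards [hterm] with u hu
  rw [Finset.sum_apply, Finset.sum_congr rfl hu, Finset.sum_eq_single (φ u)]
  · simp
  · intro c _ hc
    simp [hc.symm]
  · intro hc
    exact absurd (φ.mem_range_self u) hc

/-- The stochastic integral of simple functions preserves inner products. -/
theorem IsOrthogonalMeasure.inner_simpleOrthogonalIntegral [IsFiniteMeasure G]
    (h : IsOrthogonalMeasure P Z G) (φ ψ : SimpleFunc ℝ ℂ) :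
    inner ℂ (simpleOrthogonalIntegral Z φ) (simpleOrthogonalIntegral Z ψ) =
      inner ℂ (memLp_simpleFunc (G := G) φ).toLp (memLp_simpleFunc (G := G) ψ).toLp := by
  rw [toLp_simpleFunc_eq_sum, toLp_simpleFunc_eq_sum, simpleOrthogonalIntegral,
    simpleOrthogonalIntegral]
  simp only [sum_inner, inner_sum, inner_smul_left, inner_smul_right]
  refine Finset.sum_congr rfl fun d _ => ?_
  congr 1
  refine Finset.sum_congr rfl fun c _ => ?_
  rw [h.inner_eq (φ.measurableSet_preimage _) (ψ.measurableSet_preimage _),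
    L2.inner_indicatorConstLp_one_indicatorConstLp_one]
  rfl

end OrthogonalMeasure

section Spectral

variable {Ω : Type*} [MeasurableSpace Ω] {P : Measure Ω} {Z : VectorMeasure ℝ (Lp ℂ 2 P)}
  {G : Measure ℝ}

/-- If an element of `L²(P)` and an element of `L²(G)` have the same inner products with the
integrals of simple functions and with these functions, this remains true for all integrals. -/
theorem HasOrthogonalIntegral.inner_eq [IsFiniteMeasure G] {φ : ℝ → ℂ} {J : Ω → ℂ}
    (h : HasOrthogonalIntegral Z G φ J) (hφ : MemLp φ 2 G) (hJ : MemLp J 2 P)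
    {A : Lp ℂ 2 P} {a : Lp ℂ 2 G}
    (hAa : ∀ ψ : SimpleFunc ℝ ℂ,
      inner ℂ A (simpleOrthogonalIntegral Z ψ) = inner ℂ a (memLp_simpleFunc (G := G) ψ).toLp) :
    inner ℂ A hJ.toLp = inner ℂ a hφ.toLp := by
  obtain ⟨φn, h1, h2⟩ := h
  have l1 : Tendsto (fun n => (memLp_simpleFunc (G := G) (φn n)).toLp) atTop (𝓝 hφ.toLp) :=
    (Lp.tendsto_Lp_iff_tendsto_eLpNorm'' _ (fun n => memLp_simpleFunc (φn n)) _ hφ).2 h1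
  have l2 : Tendsto (fun n => simpleOrthogonalIntegral Z (φn n)) atTop (𝓝 hJ.toLp) :=
    (Lp.tendsto_Lp_iff_tendsto_eLpNorm _ _ hJ).2 h2
  have l3 := (tendsto_const_nhds (x := A)).inner l2 (𝕜 := ℂ)
  have l4 := (tendsto_const_nhds (x := a)).inner l1 (𝕜 := ℂ)
  simp only [hAa] at l3
  exact tendsto_nhds_unique l3 l4

/-- Distances depend only on inner products, so approximation transfers between `L²(G)` and `L²(P)`
without extending the integral to an isometry. -/
theorem norm_sub_eq_of_inner_eq {H K : Type*} [NormedAddCommGroup H] [InnerProductSpace ℂ H]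
    [NormedAddCommGroup K] [InnerProductSpace ℂ K] {x y : H} {x' y' : K}
    (h1 : inner ℂ x x = inner ℂ x' x') (h2 : inner ℂ x y = inner ℂ x' y')
    (h3 : inner ℂ y y = inner ℂ y' y') : ‖x - y‖ = ‖x' - y'‖ := by
  have e : ‖x - y‖ ^ 2 = ‖x' - y'‖ ^ 2 := by
    rw [norm_sub_sq (𝕜 := ℂ), norm_sub_sq (𝕜 := ℂ), norm_sq_eq_re_inner (𝕜 := ℂ) x,
      norm_sq_eq_re_inner (𝕜 := ℂ) y, norm_sq_eq_re_inner (𝕜 := ℂ) x',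
      norm_sq_eq_re_inner (𝕜 := ℂ) y', h1, h2, h3]
  exact (pow_left_inj₀ (norm_nonneg _) (norm_nonneg _) two_ne_zero).1 e

/-- A random variable whose inner products with itself and with all integrals of simple functions
are those of `φ` is the integral of `φ`. -/
theorem hasOrthogonalIntegral_of_inner_eq [IsFiniteMeasure G] (hZ : IsOrthogonalMeasure P Z G)
    {φ : ℝ → ℂ} {J : Ω → ℂ} (hφ : MemLp φ 2 G) (hJ : MemLp J 2 P)
    (h1 : ∀ ψ : SimpleFunc ℝ ℂ, inner ℂ (simpleOrthogonalIntegral Z ψ) hJ.toLp =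
      inner ℂ (memLp_simpleFunc (G := G) ψ).toLp hφ.toLp)
    (h2 : inner ℂ hJ.toLp hJ.toLp = inner ℂ hφ.toLp hφ.toLp) :
    HasOrthogonalIntegral Z G φ J := by
  have hex : ∀ n : ℕ, ∃ ψ : SimpleFunc ℝ ℂ, eLpNorm (φ - ⇑ψ) 2 G < ((n : ENNReal) + 1)⁻¹ :=
    fun n => by
      obtain ⟨ψ, h, -⟩ := hφ.exists_simpleFunc_eLpNorm_sub_lt (by simp)
        (ε := ((n : ENNReal) + 1)⁻¹) (by simp)
      exact ⟨ψ, h⟩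
  choose φn hφn using hex
  have l0 : Tendsto (fun n => eLpNorm (⇑(φn n) - φ) 2 G) atTop (𝓝 0) := by
    refine tendsto_of_tendsto_of_tendsto_of_le_of_le tendsto_const_nhds
      (h := fun n : ℕ => ((n : ENNReal) + 1)⁻¹) ?_ (fun n => zero_le) fun n => ?_
    · have := (tendsto_add_atTop_iff_nat 1).2 ENNReal.tendsto_inv_nat_nhds_zero
      simpa using this
    · rw [eLpNorm_sub_comm]; exact (hφn n).le
  refine ⟨φn, l0, ?_⟩
  have l1 := (Lp.tendsto_Lp_iff_tendsto_eLpNorm'' _ (fun n => memLp_simpleFunc (φn n)) _ hφ).2 l0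
  refine (Lp.tendsto_Lp_iff_tendsto_eLpNorm _ _ hJ).1 ?_
  rw [tendsto_iff_norm_sub_tendsto_zero] at l1 ⊢
  exact l1.congr fun n => (norm_sub_eq_of_inner_eq
    (hZ.inner_simpleOrthogonalIntegral _ _) (h1 _) h2).symm

theorem memLp_exp [IsFiniteMeasure G] (s : ℝ) :
    MemLp (fun u : ℝ => Complex.exp (Complex.I * s * u)) 2 G := by
  refine MemLp.of_bound (by fun_prop) 1 (Eventually.of_forall fun u => ?_)
  rw [show Complex.I * s * u = ((s * u : ℝ) : ℂ) * Complex.I by push_cast; ring,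
    Complex.norm_exp_ofReal_mul_I]

/-- Exponential averages of a process with orthogonal spectral measure: they are obtained by
integrating the exponential averages of the exponentials. -/
theorem hasOrthogonalIntegral_average [IsProbabilityMeasure P] (hZ : IsOrthogonalMeasure P Z G)
    {α : ℝ} (hα : 0 < α) {F : ℝ → Ω → ℂ} (hF : Measurable (Function.uncurry F))
    (hFL : ∀ s, MemLp (F s) 2 P)
    (hspec : ∀ s : ℝ, HasOrthogonalIntegral Z G (fun u => Complex.exp (Complex.I * s * u)) (F s))
    {C : ENNReal} (hC : C ≠ ⊤) (hFC : ∀ s, eLpNorm (F s) 2 P ≤ C) :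
    (∀ t : ℝ, HasOrthogonalIntegral Z G
      (fun u => Complex.exp (Complex.I * t * u) * (α + Complex.I * u)⁻¹)
      (fun p => (α : ℂ)⁻¹ * ∫ r, F (t - r) p ∂expWeight α)) ∧
    ∀ s t h : ℝ,
      ∫ p, starRingEnd ℂ ((α : ℂ)⁻¹ * ∫ r, F (s + h - r) p ∂expWeight α) *
        ((α : ℂ)⁻¹ * ∫ r, F (t + h - r) p ∂expWeight α) ∂P =
      ∫ p, starRingEnd ℂ ((α : ℂ)⁻¹ * ∫ r, F (s - r) p ∂expWeight α) *
        ((α : ℂ)⁻¹ * ∫ r, F (t - r) p ∂expWeight α) ∂P := by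
  have := hZ.isFiniteMeasure
  have := isProbabilityMeasure_expWeight hα
  set e : ℝ → ℝ → ℂ := fun s u => Complex.exp (Complex.I * s * u) with he
  have heL : ∀ s, MemLp (e s) 2 G := fun s => memLp_exp s
  have hαc : (α : ℂ) ≠ 0 := by exact_mod_cast hα.ne'
  -- measurability of the shifted families
  have hFt : ∀ t : ℝ, Measurable (Function.uncurry fun r p => F (t - r) p) := fun t =>
    hF.comp ((measurable_const.sub measurable_fst).prodMk measurable_snd)
  have het : ∀ t : ℝ, Measurable (Function.uncurry fun r u => e (t - r) u) := fun t => by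
    simp only [he, Function.uncurry_def]; fun_prop
  obtain ⟨C', hC', heC⟩ : ∃ C' : ENNReal, C' ≠ ⊤ ∧ ∀ s, eLpNorm (e s) 2 G ≤ C' := by
    refine ⟨_, ?_, fun s => eLpNorm_le_of_ae_bound (C := 1) (Eventually.of_forall fun u => ?_)⟩
    · exact ENNReal.mul_ne_top (ENNReal.rpow_ne_top_of_nonneg (by positivity) (measure_ne_top _ _))
        ENNReal.ofReal_ne_top
    · simp only [he]
      rw [show Complex.I * s * u = ((s * u : ℝ) : ℂ) * Complex.I by push_cast; ring,
        Complex.norm_exp_ofReal_mul_I]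
  have hK := fun t => memLp_integral_of_eLpNorm_le (ν := expWeight α) (hFt t) hC
    (fun r => hFC (t - r))
  have hψ := fun t => memLp_integral_of_eLpNorm_le (ν := expWeight α) (het t) hC'
    (fun r => heC (t - r))
  -- equality of inner products
  have i1 : ∀ (φ : SimpleFunc ℝ ℂ) s, inner ℂ (simpleOrthogonalIntegral Z φ) (hFL s).toLp =
      inner ℂ (memLp_simpleFunc (G := G) φ).toLp (heL s).toLp := fun φ s =>
    (hspec s).inner_eq (heL s) (hFL s) fun ψ => hZ.inner_simpleOrthogonalIntegral φ ψ
  have i2 : ∀ r s, inner ℂ (hFL r).toLp (hFL s).toLp = inner ℂ (heL r).toLp (heL s).toLp :=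
    fun r s => (hspec s).inner_eq (heL s) (hFL s) fun ψ => by
      rw [← inner_conj_symm, i1, inner_conj_symm]
  -- Matching inner products with all `F s` and `e s` pass to the averages. Applied to each argument
  -- in turn, this matches the inner products of two averages.
  have transfer : ∀ {A : Lp ℂ 2 P} {a : Lp ℂ 2 G},
      (∀ s, inner ℂ A (hFL s).toLp = inner ℂ a (heL s).toLp) →
      ∀ t, inner ℂ A (hK t).toLp = inner ℂ a (hψ t).toLp := by
    intro A a hAa t
    rw [inner_toLp_integral (hFt t) hC (fun r => hFC (t - r)) (fun r => hFL (t - r)),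
      inner_toLp_integral (het t) hC' (fun r => heC (t - r)) (fun r => heL (t - r))]
    simp only [hAa]
  have i3 : ∀ (φ : SimpleFunc ℝ ℂ) t, inner ℂ (simpleOrthogonalIntegral Z φ) (hK t).toLp =
      inner ℂ (memLp_simpleFunc (G := G) φ).toLp (hψ t).toLp := fun φ => transfer (i1 φ)
  have i4 : ∀ s t, inner ℂ (hK s).toLp (hK t).toLp = inner ℂ (hψ s).toLp (hψ t).toLp :=
    fun s => transfer fun r => by
      rw [← inner_conj_symm, transfer (i2 r), inner_conj_symm]
  have hKa : ∀ t, MemLp (fun p => (α : ℂ)⁻¹ * ∫ r, F (t - r) p ∂expWeight α) 2 P :=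
    fun t => (hK t).const_mul _
  have hψa : ∀ t, MemLp (fun u => (α : ℂ)⁻¹ * ∫ r, e (t - r) u ∂expWeight α) 2 G :=
    fun t => (hψ t).const_mul _
  have hKs : ∀ t, (hKa t).toLp = (α : ℂ)⁻¹ • (hK t).toLp := fun t => rfl
  have hψs : ∀ t, (hψa t).toLp = (α : ℂ)⁻¹ • (hψ t).toLp := fun t => rfl
  have j3 : ∀ (φ : SimpleFunc ℝ ℂ) t, inner ℂ (simpleOrthogonalIntegral Z φ) (hKa t).toLp =
      inner ℂ (memLp_simpleFunc (G := G) φ).toLp (hψa t).toLp := fun φ t => by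
    rw [hKs, hψs, inner_smul_right, inner_smul_right, i3]
  have j4 : ∀ s t, inner ℂ (hKa s).toLp (hKa t).toLp = inner ℂ (hψa s).toLp (hψa t).toLp :=
    fun s t => by
      rw [hKs, hψs, hKs, hψs, inner_smul_right, inner_smul_right, inner_smul_left, inner_smul_left,
        i4]
  have hψeq : ∀ t, (fun u => (α : ℂ)⁻¹ * ∫ r, e (t - r) u ∂expWeight α) =
      fun u : ℝ => Complex.exp (Complex.I * t * u) * (α + Complex.I * u)⁻¹ := fun t => by
    ext u
    simp only [he]
    rw [integral_exp_expWeight hα, inv_mul_cancel_left₀ hαc]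
  refine ⟨fun t => ?_, fun s t h => ?_⟩
  · rw [← hψeq t]
    exact hasOrthogonalIntegral_of_inner_eq hZ (hψa t) (hKa t) (fun φ => j3 φ t) (j4 t t)
  -- Stationarity is read off in `L²(G)`: a shift by `h` multiplies both factors by `e^{ihu}`, which
  -- cancels against its conjugate.
  · rw [← inner_toLp_toLp (hKa _) (hKa _), ← inner_toLp_toLp (hKa s) (hKa t), j4, j4,
      inner_toLp_toLp, inner_toLp_toLp]
    refine integral_congr_ae (Eventually.of_forall fun u => ?_)
    have hs := fun t => congrFun (hψeq t) u
    simp only at hs ⊢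
    rw [hs, hs, hs, hs]
    have hexp : ∀ t : ℝ, Complex.exp (Complex.I * t * u) =
        Complex.exp (((t * u : ℝ) : ℂ) * Complex.I) := fun t => by
      congr 1; push_cast; ring
    simp only [map_mul, hexp, ← Complex.exp_conj, Complex.conj_ofReal, Complex.conj_I]
    rw [mul_mul_mul_comm, mul_mul_mul_comm (Complex.exp (((s * u : ℝ) : ℂ) * -Complex.I)),
      ← Complex.exp_add, ← Complex.exp_add]
    congr 2
    push_cast; ring

end Spectral

/-! ### Averages over the past as solutions. -/

theorem integrable_expWeight_iff {α : ℝ} (hα : 0 < α) {g : ℝ → ℝ} :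
    Integrable g (expWeight α) ↔
      IntegrableOn (fun r => (α * Real.exp (-(α * r))) * g r) (Set.Ioi 0) := by
  rw [expWeight, integrable_withDensity_iff_integrable_smul' (by fun_prop) (by simp), IntegrableOn]
  refine integrable_congr (Eventually.of_forall fun r => ?_)
  simp only [smul_eq_mul]
  rw [ENNReal.toReal_ofReal (by positivity)]

theorem indicator_Ioi_sub {α : ℝ} (g : ℝ → ℝ) (t s : ℝ) :
    (Set.Ioi 0).indicator (fun r => (α * Real.exp (-(α * r))) * g (t - r)) (t - s) =
      (Set.Iio t).indicator
        (fun s => α * Real.exp (-(α * t)) * (Real.exp (α * s) * g s)) s := by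
  by_cases hs : s < t
  · rw [Set.indicator_of_mem (by simpa using hs), Set.indicator_of_mem (by simpa using hs),
      sub_sub_cancel, show -(α * (t - s)) = -(α * t) + α * s by ring, Real.exp_add]
    ring
  · rw [Set.indicator_of_notMem (by simpa using hs), Set.indicator_of_notMem (by simpa using hs)]

theorem integrableOn_Iic_of_integrable_expWeight {α : ℝ} (hα : 0 < α) {g : ℝ → ℝ} {t : ℝ}
    (h : Integrable (fun r => g (t - r)) (expWeight α)) :
    IntegrableOn (fun s => Real.exp (α * s) * g s) (Set.Iic t) := by
  rw [integrable_expWeight_iff hα, ← integrable_indicator_iff measurableSet_Ioi] at h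
  have h1 := h.comp_sub_left t
  simp only [indicator_Ioi_sub] at h1
  rw [integrable_indicator_iff measurableSet_Iio] at h1
  rw [integrableOn_Iic_iff_integrableOn_Iio]
  have h2 := h1.const_mul (α * Real.exp (-(α * t)))⁻¹
  have hne : α * Real.exp (-(α * t)) ≠ 0 := by positivity
  simpa only [inv_mul_cancel_left₀ hne, IntegrableOn] using h2

theorem integral_expWeight_sub {α : ℝ} (hα : 0 < α) (g : ℝ → ℝ) (t : ℝ) :
    ∫ r, g (t - r) ∂expWeight α =
      α * Real.exp (-(α * t)) * ∫ s in Set.Iic t, Real.exp (α * s) * g s := by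
  rw [integral_expWeight hα, ← integral_indicator measurableSet_Ioi,
    ← integral_sub_left_eq_self _ volume t]
  simp only [smul_eq_mul, indicator_Ioi_sub]
  rw [integral_indicator measurableSet_Iio, integral_const_mul, integral_Iic_eq_integral_Iio]

/-- Substituting `s = t - r` gives Duhamel's formula started at `-∞`, with constant `∫_{-∞}^0 e^{αs}
g(s) ds`; the centring `c` cancels. Integrability at natural times controls every half-line, so only
countably many conditions occur. -/
theorem isRelaxationSolution_expWeight {α : ℝ} (hα : 0 < α) {g : ℝ → ℝ} (c : ℝ)
    (h : ∀ n : ℕ, Integrable (fun r => g (n - r)) (expWeight α)) :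
    LocallyIntegrable g ∧
      IsRelaxationSolution α g (fun t => c / α + α⁻¹ * ∫ r, (g (t - r) - c) ∂expWeight α) := by
  have := isProbabilityMeasure_expWeight hα
  have hI : ∀ t, IntegrableOn (fun s => Real.exp (α * s) * g s) (Set.Iic t) := fun t => by
    obtain ⟨n, hn⟩ := exists_nat_ge t
    exact (integrableOn_Iic_of_integrable_expWeight hα (h n)).mono_set (Set.Iic_subset_Iic.2 hn)
  have hloc : LocallyIntegrable g := by
    have h1 : LocallyIntegrable (fun s => Real.exp (α * s) * g s) := fun t =>
      ⟨Set.Iic (t + 1), Iic_mem_nhds (by linarith), hI _⟩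
    rw [← locallyIntegrableOn_univ] at h1 ⊢
    have hc : Continuous fun s : ℝ => Real.exp (-(α * s)) := by fun_prop
    have h2 := h1.continuousOn_mul hc.continuousOn isOpen_univ.isLocallyClosed
    refine h2.congr ?_
    refine Eventually.of_forall fun s => ?_
    simp only
    rw [← mul_assoc, ← Real.exp_add]; simp
  refine ⟨hloc, ?_⟩
  have hint : ∀ t, Integrable (fun r => g (t - r)) (expWeight α) := fun t => by
    rw [integrable_expWeight_iff hα, ← integrable_indicator_iff measurableSet_Ioi]
    have h1 := ((hI t).mono_set Set.Iio_subset_Iic_self).const_mul (α * Real.exp (-(α * t)))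
    replace h1 := (integrable_indicator_iff measurableSet_Iio).2 h1
    have h2 := h1.comp_sub_left t
    refine h2.congr (Eventually.of_forall fun r => ?_)
    simp only
    rw [← indicator_Ioi_sub, sub_sub_cancel]
  have key := isRelaxationSolution_duhamel α hloc (∫ s in Set.Iic 0, Real.exp (α * s) * g s)
  convert key using 1
  ext t
  rw [integral_sub (hint t) (integrable_const c), integral_expWeight_sub hα,
    ← intervalIntegral.integral_Iic_sub_Iic (hI 0) (hI t), integral_const]
  simp
  field_simp
  ring

/-! ### The stationary solution. -/

section Stationary

variable {Ω : Type*}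

/-- The stationary solution of `w' = f - α w` for a second-order stationary force of mean `m`. -/
noncomputable def stationarySolution (α m : ℝ) (f : ℝ → Ω → ℝ) (t : ℝ) (p : Ω) : ℝ :=
  m / α + α⁻¹ * ∫ r, (f (t - r) p - m) ∂expWeight α

theorem ofReal_stationarySolution_sub (α m : ℝ) (f : ℝ → Ω → ℝ) (t : ℝ) (p : Ω) :
    ((stationarySolution α m f t p - m / α : ℝ) : ℂ) =
      (α : ℂ)⁻¹ * ∫ r, ((f (t - r) p - m : ℝ) : ℂ) ∂expWeight α := by
  rw [integral_complex_ofReal]; simp [stationarySolution]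

variable [MeasurableSpace Ω] {P : Measure Ω}

theorem IsSecondOrderStationary.eLpNorm_sub_mean [IsProbabilityMeasure P] {f : ℝ → Ω → ℝ}
    (hf : IsSecondOrderStationary P f) {m : ℝ} (hm : ∀ s, ∫ p, f s p ∂P = m) (s : ℝ) :
    eLpNorm (fun p => f s p - m) 2 P = eLpNorm (fun p => f 0 p - m) 2 P := by
  have hv : ∀ s, eLpNorm (fun p => f s p - m) 2 P ^ 2 =
      ENNReal.ofReal (covariance (f 0) (f 0) P) := fun s => by
    have h1 := hf.cov 0 0 s
    rw [zero_add] at h1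
    rw [eLpNorm_two_sq_eq_lintegral, ← h1, covariance_self (hf.memLp s).aemeasurable,
      ofReal_variance (hf.memLp s), evariance, hm]
  have h2 := (hv s).trans (hv 0).symm
  exact le_antisymm ((ENNReal.pow_le_pow_left_iff two_ne_zero).1 h2.le)
    ((ENNReal.pow_le_pow_left_iff two_ne_zero).1 h2.ge)

theorem measurable_uncurry_sub_sub {f : ℝ → Ω → ℝ} (hmeas : Measurable (Function.uncurry f))
    (m t : ℝ) : Measurable (Function.uncurry fun r p => f (t - r) p - m) :=
  (hmeas.comp ((measurable_const.sub measurable_fst).prodMk measurable_snd)).sub measurable_const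

variable [IsProbabilityMeasure P] {α m : ℝ} {f : ℝ → Ω → ℝ}

theorem IsSecondOrderStationary.memLp_sub_const (hf : IsSecondOrderStationary P f) (m s : ℝ) :
    MemLp (fun p => f s p - m) 2 P :=
  (hf.memLp s).sub (memLp_const m)

theorem IsSecondOrderStationary.memLp_stationarySolution (hf : IsSecondOrderStationary P f)
    (hα : 0 < α) (hmeas : Measurable (Function.uncurry f)) (hm : ∀ s, ∫ p, f s p ∂P = m) (t : ℝ) :
    MemLp (stationarySolution α m f t) 2 P ∧ ∫ p, stationarySolution α m f t p ∂P = m / α := by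
  have := isProbabilityMeasure_expWeight hα
  have hC := (hf.memLp_sub_const m 0).eLpNorm_ne_top
  have hfC : ∀ r, eLpNorm (fun p => f (t - r) p - m) 2 P ≤ eLpNorm (fun p => f 0 p - m) 2 P :=
    fun r => (hf.eLpNorm_sub_mean hm (t - r)).le
  have hK : MemLp (fun p => ∫ r, (f (t - r) p - m) ∂expWeight α) 2 P :=
    memLp_integral_of_eLpNorm_le (measurable_uncurry_sub_sub hmeas m t) hC hfC
  refine ⟨(memLp_const (m / α)).add (hK.const_mul α⁻¹), ?_⟩
  have h1 := integrable_prod_of_eLpNorm_le (ν := expWeight α)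
    (measurable_uncurry_sub_sub hmeas m t) hC hfC (memLp_const (1 : ℝ))
  simp only [one_mul] at h1
  have h2 : ∫ p, ∫ r, (f (t - r) p - m) ∂expWeight α ∂P = 0 := by
    rw [integral_integral_swap (f := fun p r => f (t - r) p - m) h1]
    have : ∀ r, ∫ p, (f (t - r) p - m) ∂P = 0 := fun r => by
      rw [integral_sub ((hf.memLp _).integrable (by norm_num)) (integrable_const m), hm]; simp
    simp [this]
  simp only [stationarySolution]
  rw [integral_add (integrable_const _) ((hK.integrable (by norm_num)).const_mul _),
    integral_const_mul, h2]
  simp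

/-- Fubini gives integrability of the past almost surely for each natural time; countability yields
one null set valid for all `t`, hence for all trajectories. -/
theorem IsSecondOrderStationary.ae_isRelaxationSolution (hf : IsSecondOrderStationary P f)
    (hα : 0 < α) (hmeas : Measurable (Function.uncurry f)) (hm : ∀ s, ∫ p, f s p ∂P = m) :
    ∀ᵐ p ∂P, LocallyIntegrable (fun t => f t p) ∧
      IsRelaxationSolution α (fun t => f t p) (fun t => stationarySolution α m f t p) := by
  have := isProbabilityMeasure_expWeight hα
  have hae : ∀ᵐ p ∂P, ∀ n : ℕ, Integrable (fun r => f (n - r) p) (expWeight α) := by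
    rw [ae_all_iff]
    intro n
    have h1 := integrable_prod_of_eLpNorm_le (ν := expWeight α)
      (measurable_uncurry_sub_sub hmeas m n) (hf.memLp_sub_const m 0).eLpNorm_ne_top
      (fun r => (hf.eLpNorm_sub_mean hm (n - r)).le) (memLp_const (1 : ℝ))
    filter_upwards [h1.prod_right_ae] with p hp
    refine (hp.add (integrable_const m)).congr (Eventually.of_forall fun r => ?_)
    simp
  filter_upwards [hae] with p hp
  exact isRelaxationSolution_expWeight hα m hp

theorem IsSecondOrderStationary.stationarySolution_spectral (hf : IsSecondOrderStationary P f)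
    {Z : VectorMeasure ℝ (Lp ℂ 2 P)} {G : Measure ℝ} (hα : 0 < α)
    (hmeas : Measurable (Function.uncurry f)) (hm : ∀ s, ∫ p, f s p ∂P = m)
    (hZ : IsOrthogonalMeasure P Z G)
    (hspec : ∀ s : ℝ, HasOrthogonalIntegral Z G (fun u => Complex.exp (Complex.I * s * u))
      (fun p => ((f s p - m : ℝ) : ℂ))) :
    IsSecondOrderStationary P (stationarySolution α m f) ∧
      ∀ t : ℝ, HasOrthogonalIntegral Z G
        (fun u => Complex.exp (Complex.I * t * u) * (α + Complex.I * u)⁻¹)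
        (fun p => ((stationarySolution α m f t p - m / α : ℝ) : ℂ)) := by
  have hmeas0 : Measurable (Function.uncurry fun s p => ((f s p - m : ℝ) : ℂ)) :=
    Complex.measurable_ofReal.comp (hmeas.sub measurable_const)
  obtain ⟨hI, hcov⟩ := hasOrthogonalIntegral_average hZ hα hmeas0
    (fun s => (hf.memLp_sub_const m s).ofReal (K := ℂ)) hspec
    (hf.memLp_sub_const m 0).eLpNorm_ne_top (fun s => by
      rw [← hf.eLpNorm_sub_mean hm s]
      refine (eLpNorm_congr_norm_ae (Eventually.of_forall fun p => ?_)).le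
      rw [Complex.norm_real])
  simp only [← ofReal_stationarySolution_sub] at hI hcov
  have hw := hf.memLp_stationarySolution hα hmeas hm
  refine ⟨⟨fun t => (hw t).1, fun s t => (hw s).2.trans (hw t).2.symm, fun s t h => ?_⟩, hI⟩
  have h1 := hcov s t h
  simp only [Complex.conj_ofReal, ← Complex.ofReal_mul] at h1
  rw [integral_complex_ofReal, integral_complex_ofReal] at h1
  simp only [covariance, (hw _).2]
  exact_mod_cast h1

end Stationary

/-! ### The theorem: a suitable `w` for each type of force. -/

theorem mainTheorem5 (N : ℕ) (hN : 0 < N) (L ω α : ℝ) (hL : 0 < L) (hω : 0 < ω) (hα : 0 < α) :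
    -- all gaps converge
    (∀ f : ℝ → ℝ, LocallyIntegrable f → ∀ x v : ℤ → ℝ → ℝ, IsElasticTrajectory N L ω α f x v →
      ∀ k, Tendsto (fun t => x (k + 1) t - x k t) atTop (𝓝 (L / N))) ∧
    -- constant force
    (∀ c : ℝ, ∀ x v : ℤ → ℝ → ℝ, IsElasticTrajectory N L ω α (fun _ => c) x v →
      ∀ k, Tendsto (v k) atTop (𝓝 (c / α))) ∧
    -- periodic force with convergent Fourier series
    (∀ f : ℝ → ℝ, LocallyIntegrable f → Function.Periodic f (2 * Real.pi) →
      (∀ t, Tendsto (fun n => trigPartialSum (fourierCoefficient f) n t) atTop (𝓝 (f t : ℂ))) →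
      ∃ w : ℝ → ℝ, Function.Periodic w (2 * Real.pi) ∧
        (∀ t, Tendsto
          (fun n => trigPartialSum (fun m => fourierCoefficient f m / (α + Complex.I * m)) n t)
          atTop (𝓝 (w t : ℂ))) ∧
        ∀ x v : ℤ → ℝ → ℝ, IsElasticTrajectory N L ω α f x v →
          ∀ k, Tendsto (fun t => v k t - w t) atTop (𝓝 0)) ∧
    -- second-order stationary force
    (∀ (Ω : Type*) [MeasurableSpace Ω] (P : Measure Ω) [IsProbabilityMeasure P]
      (f : ℝ → Ω → ℝ) (fbar : ℝ) (Z : VectorMeasure ℝ (Lp ℂ 2 P)) (G : Measure ℝ),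
      Measurable (Function.uncurry f) →
      IsSecondOrderStationary P f →
      Continuous (fun t => covariance (f t) (f 0) P) →
      (∀ s, ∫ p, f s p ∂P = fbar) →
      IsOrthogonalMeasure P Z G →
      (∀ s : ℝ, HasOrthogonalIntegral Z G (fun u => Complex.exp (Complex.I * s * u))
        (fun p => ((f s p - fbar : ℝ) : ℂ))) →
      ∃ w : ℝ → Ω → ℝ, IsSecondOrderStationary P w ∧
        (∀ t : ℝ, HasOrthogonalIntegral Z G
          (fun u => Complex.exp (Complex.I * t * u) * (α + Complex.I * u)⁻¹)
          (fun p => ((w t p - fbar / α : ℝ) : ℂ))) ∧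
        ∀ᵐ p ∂P, ∀ x v : ℤ → ℝ → ℝ, IsElasticTrajectory N L ω α (fun t => f t p) x v →
          ∀ k, Tendsto (fun t => x (k + 1) t - x k t) atTop (𝓝 (L / N)) ∧
            Tendsto (fun t => v k t - w t p) atTop (𝓝 0)) := by
  refine ⟨fun f hf x v h k => ?_, fun c x v h k => ?_, fun f hf hper _ => ?_, ?_⟩
  · exact (h.tendsto_gap_and_velocity hN hL hω hα hf
      (isRelaxationSolution_duhamel α hf 0) k).1
  · have := (h.tendsto_gap_and_velocity hN hL hω hα (locallyIntegrable_const c)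
      (isRelaxationSolution_const hα c) k).2
    simpa using this.add_const (c / α)
  · obtain ⟨w, hw, hwper, hws⟩ := exists_periodic_isRelaxationSolution hα hf hper
    exact ⟨w, hwper, hws, fun x v h k => (h.tendsto_gap_and_velocity hN hL hω hα hf hw k).2⟩
  · intro Ω _ P _ f fbar Z G hmeas hf _ hm hZ hspec
    obtain ⟨hw, hwI⟩ := hf.stationarySolution_spectral hα hmeas hm hZ hspec
    refine ⟨stationarySolution α fbar f, hw, hwI, ?_⟩
    filter_upwards [hf.ae_isRelaxationSolution hα hmeas hm] with p hp x v h k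
    exact h.tendsto_gap_and_velocity hN hL hω hα hp.1 hp.2 k
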